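/- Let $\Gamma$ be a finite connected simplicial graph. Let $A(\Gamma)$ be the right-angled Artin group on $\Gamma$ (generated by the vertices of $\Gamma$, with the relation $[v,w]=1$ for every edge $\{v,w\}$), and let $\Gamma^e$ be its extension graph: the vertices are the elements $g^{-1}vg$ of $A(\Gamma)$ with $v$ a vertex of $\Gamma$ and $g\in A(\Gamma)$, and two distinct vertices are adjacent if and only if they commute in $A(\Gamma)$. Then $\Gamma^e$ is connected and, with its graph metric, is a quasi-tree (i.e. it is quasi-isometric to a simplicial tree), and in particular it is $\delta$-hyperbolic for some $\delta\ge 0$. More precisely: (1) If $\Gamma$ splits as a nontrivial join (i.e. the complement graph of $\Gamma$ is disconnected), then $\Gamma^e$ has finite diameter, and is hence quasi-isometric to a point. (2) If $\Gamma$ has at least two vertices and does not split as a nontrivial join, then $\Gamma^e$ is quasi-isometric to a regular simplicial tree of countable degree, i.e. a tree in which every vertex has countably infinitely many neighbours. -/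

import Mathlib

universe u v

/-- The right-angled Artin group `A(Γ)`: one generator for each vertex of `Γ`, and one commutator
relation `[a, b] = 1` for each edge `{a, b}` of `Γ`. -/
abbrev RAAG {V : Type u} (Γ : SimpleGraph V) : Type u :=
  PresentedGroup {r : FreeGroup V | ∃ a b : V, Γ.Adj a b ∧
    r = FreeGroup.of a * FreeGroup.of b * (FreeGroup.of a)⁻¹ * (FreeGroup.of b)⁻¹}

/-- The vertex generator of `A(Γ)` given by a vertex of `Γ`. -/
def RAAG.gen {V : Type u} (Γ : SimpleGraph V) (a : V) : RAAG Γ :=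
  PresentedGroup.of a

/-- The vertices of the extension graph: the elements `g⁻¹ a g` of `A(Γ)`, with `a` a vertex
generator and `g` an element of `A(Γ)`. -/
def ExtensionVertex {V : Type u} (Γ : SimpleGraph V) : Type u :=
  {x : RAAG Γ // ∃ (a : V) (g : RAAG Γ), x = g⁻¹ * RAAG.gen Γ a * g}

/-- The extension graph `Γ^e`: two distinct conjugates of vertex generators are adjacent if and
only if they commute in `A(Γ)`. -/
def extensionGraph {V : Type u} (Γ : SimpleGraph V) : SimpleGraph (ExtensionVertex Γ) where
  Adj x y := x ≠ y ∧ Commute x.1 y.1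
  symm := ⟨fun _ _ h => ⟨h.1.symm, h.2.symm⟩⟩
  loopless := ⟨fun _ h => h.1 rfl⟩

/-- A nonempty graph splits as a nontrivial join if its complement graph is disconnected. -/
def IsNontrivialJoin {V : Type u} (Γ : SimpleGraph V) : Prop :=
  ¬ Γᶜ.Preconnected

/-- The graph metric, as a real number. (It is a metric when the graph is connected.) -/
noncomputable def graphDist {V : Type u} (G : SimpleGraph V) (x y : V) : ℝ :=
  (G.dist x y : ℝ)

/-- `f` is a quasi-isometry from the set `X` with metric `dX` to the set `Y` with metric `dY`. -/
def IsQuasiIsometry {X : Type u} {Y : Type v} (dX : X → X → ℝ) (dY : Y → Y → ℝ)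
    (f : X → Y) : Prop :=
  ∃ K C : ℝ, 1 ≤ K ∧ 0 ≤ C ∧
    (∀ x z : X, 1 / K * dX x z - C ≤ dY (f x) (f z) ∧ dY (f x) (f z) ≤ K * dX x z + C) ∧
    ∀ y : Y, ∃ x : X, dY (f x) y ≤ C

/-- Two connected graphs are quasi-isometric if there is a quasi-isometry between them, for their
graph metrics. -/
def QuasiIsometric {V : Type u} {W : Type v} (G : SimpleGraph V) (H : SimpleGraph W) : Prop :=
  G.Connected ∧ H.Connected ∧ ∃ f : V → W, IsQuasiIsometry (graphDist G) (graphDist H) f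

/-- A quasi-tree is a graph that is quasi-isometric to a simplicial tree. -/
def IsQuasiTree {V : Type u} (G : SimpleGraph V) : Prop :=
  ∃ (W : Type u) (T : SimpleGraph W), T.IsTree ∧ QuasiIsometric G T

/-- A walk is geodesic if its length is the distance of its endpoints. -/
def IsGeodesicWalk {V : Type u} {G : SimpleGraph V} {x y : V} (p : G.Walk x y) : Prop :=
  p.length = G.dist x y

/-- A connected graph is `δ`-hyperbolic for some `δ ≥ 0`: in every geodesic triangle, each side
lies in the `δ`-neighbourhood of the union of the other two sides. -/
def IsHyperbolicGraph {V : Type u} (G : SimpleGraph V) : Prop :=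
  G.Connected ∧ ∃ δ : ℝ, 0 ≤ δ ∧
    ∀ (x y z : V) (p : G.Walk x y) (q : G.Walk y z) (r : G.Walk x z),
      IsGeodesicWalk p → IsGeodesicWalk q → IsGeodesicWalk r →
        ∀ a ∈ r.support, ∃ b, (b ∈ p.support ∨ b ∈ q.support) ∧ graphDist G a b ≤ δ

/-- The one-point graph. -/
def pointGraph : SimpleGraph Unit := ⊥

/-- `T` is a regular simplicial tree of countable degree: a tree in which every vertex has a
countably infinite set of neighbours. -/
def IsCountablyRegularTree {W : Type u} (T : SimpleGraph W) : Prop :=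
  T.IsTree ∧ ∀ w : W, (T.neighborSet w).Countable ∧ (T.neighborSet w).Infinite

universe w

/-!
The extension graph is a quasi-tree because it falls apart along stars of its vertices.

For a generator `a`, let `star a` be the subgroup generated by `a` and its neighbours. There is a
function `RAAG.crossing a : A(Γ) → ℤ` which, when an element `g` is multiplied on the left by a
generator `b`, changes (by `1`) only if `b = a` and `g ∈ star a`; this prescription is compatible
with the commutation relations, so no normal forms are needed. On the other hand, multiplication
by `a` on the right always adds `1`. Comparing the two for an element commuting with `a` shows that
the centralizer of `a` is `star a` (`RAAG.mem_star_iff_commute`), and a retraction onto `star a`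
then shows that commuting conjugates of generators are simultaneously conjugate to commuting
generators (`RAAG.exists_common_conj`). It follows that the crossing number relative to
`k⁻¹ v k` is a well-defined function on the vertices outside the star of `k⁻¹ v k`, constant along
edges: the star of `k⁻¹ v k` separates the vertices with different crossing numbers
(`RAAG.exists_commute_of_crossing_ne`).

The extension graph is the union of the copies `g⁻¹ Γ g` of `Γ`, which have bounded diameter. Along
a reduced word, consecutive copies share a vertex whose star separates the two ends, since a
generator crossed in both directions could be cancelled. This gives Manning's bottleneck property
(`RAAG.exists_hasBottleneck`), and hyperbolicity at once. A graph with the bottleneck property is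
quasi-isometric to the tree of components of the complements of the balls about a base point
(`HasBottleneck.quasiIsometric_layer`), because the points in which such a component meets a
sphere are uniformly close to each other.

If `Γ` is a join, then all conjugates of generators on one side commute with all generators on the
other side, so the extension graph is bounded. If `Γ` is not a join and has at least two vertices,
its complement carries a periodic walk through all vertices. Its letters, conjugated by the
products of the preceding letters, form a sequence of vertices of the extension graph; the star of
each separates its predecessors from its successors. A vertex adjacent to two of them that are a
period apart is adjacent to all members in between, hence central, which is impossible. So
the extension graph is unbounded (`RAAG.extensionGraph_unbounded`). Conjugating a far vertex by the
powers of a given vertex then produces infinitely many far vertices pairwise separated by the star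
of the latter (`RAAG.hasBranching_of_unbounded`), and this makes the tree of components regular of
countably infinite degree (`HasBranching.infinite_neighborSet`).
-/

/-! ### Geodesics -/

theorem dist_add_dist_of_mem_geodesic {X : Type u} {G : SimpleGraph X} (hG : G.Connected)
    {x z b : X} (p : G.Walk x z) (hp : p.length = G.dist x z) (hb : b ∈ p.support) :
    G.dist x b + G.dist b z = G.dist x z := by
  classical
  have h1 := SimpleGraph.dist_le (p.takeUntil b hb)
  have h2 := SimpleGraph.dist_le (p.dropUntil b hb)
  have h3 := congrArg SimpleGraph.Walk.length (p.take_spec hb)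
  rw [SimpleGraph.Walk.length_append] at h3
  have h4 := hG.dist_triangle (u := x) (v := b) (w := z)
  omega

theorem exists_dist_eq_on_geodesic {X : Type u} {G : SimpleGraph X} (hG : G.Connected) (x z : X)
    {n : ℕ} (hn : n ≤ G.dist x z) :
    ∃ a, G.dist x a = n ∧ G.dist x a + G.dist a z = G.dist x z := by
  obtain ⟨p, hp⟩ := hG.exists_walk_length_eq_dist x z
  have h1 := SimpleGraph.dist_le (p.take n)
  have h2 := SimpleGraph.dist_le (p.drop n)
  have h3 := hG.dist_triangle (u := x) (v := p.getVert n) (w := z)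
  rw [SimpleGraph.Walk.take_length] at h1
  rw [SimpleGraph.Walk.drop_length] at h2
  exact ⟨p.getVert n, by omega, by omega⟩

theorem exists_walk_through_geodesic {X : Type u} {G : SimpleGraph X} (hG : G.Connected) {x z a : X}
    (ha : G.dist x a + G.dist a z = G.dist x z) :
    ∃ p : G.Walk x z, ∀ b ∈ p.support,
      G.dist x b = G.dist x a + G.dist a b ∨ G.dist x a = G.dist x b + G.dist a b := by
  obtain ⟨p, hp⟩ := hG.exists_walk_length_eq_dist x a
  obtain ⟨q, hq⟩ := hG.exists_walk_length_eq_dist a z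
  refine ⟨p.append q, fun b hb => ?_⟩
  rcases (SimpleGraph.Walk.mem_support_append_iff _ _).1 hb with h | h
  · right
    have := dist_add_dist_of_mem_geodesic hG p hp h
    rw [G.dist_comm (u := a) (v := b)]
    omega
  · left
    have := dist_add_dist_of_mem_geodesic hG q hq h
    have h1 := hG.dist_triangle (u := x) (v := b) (w := z)
    have h2 := hG.dist_triangle (u := x) (v := a) (w := b)
    omega

/-! ### The bottleneck property and hyperbolicity -/

/-- Manning's bottleneck property with constant `c`: a walk between the ends of a geodesic passes
within distance `c` of every vertex of that geodesic. The vertices `a` lying on a geodesic from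
`x` to `z` are those with `d(x, a) + d(a, z) = d(x, z)`. -/
def HasBottleneck {X : Type u} (G : SimpleGraph X) (c : ℕ) : Prop :=
  ∀ x z a : X, G.dist x a + G.dist a z = G.dist x z →
    ∀ p : G.Walk x z, ∃ b ∈ p.support, G.dist a b ≤ c

theorem HasBottleneck.isHyperbolicGraph {X : Type u} {G : SimpleGraph X} {c : ℕ} (hG : G.Connected)
    (hB : HasBottleneck G c) : IsHyperbolicGraph G := by
  refine ⟨hG, c, by positivity, fun x y z p q r _ _ hr a ha => ?_⟩
  obtain ⟨b, hb, hab⟩ := hB x z a (dist_add_dist_of_mem_geodesic hG r hr ha) (p.append q)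
  exact ⟨b, (SimpleGraph.Walk.mem_support_append_iff _ _).1 hb, by
    unfold graphDist; exact_mod_cast hab⟩

/-- A criterion for the bottleneck property: it suffices that between any `x` and `z` there are
vertices `y` whose unit balls are met by every walk from `x` to `z`, and whose distances from `x`
are `D`-dense among the integers up to `d(x, z)`. -/
theorem hasBottleneck_of_separators {X : Type u} {G : SimpleGraph X} (hG : G.Connected) (D : ℕ)
    (h : ∀ x z : X, ∀ r ≤ G.dist x z, ∃ y : X, G.dist x y ≤ r + D ∧ r ≤ G.dist x y + D ∧
      ∀ p : G.Walk x z, ∃ b ∈ p.support, G.dist y b ≤ 1) :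
    HasBottleneck G (D + 3) := by
  intro x z a ha p
  obtain ⟨y, hy1, hy2, hy⟩ := h x z (G.dist x a) (by omega)
  obtain ⟨b, hb, hyb⟩ := hy p
  obtain ⟨q, hq⟩ := exists_walk_through_geodesic hG ha
  obtain ⟨b', hb', hyb'⟩ := hy q
  have h1 := hq b' hb'
  have h2 := hG.dist_triangle (u := x) (v := y) (w := b')
  have h3 := hG.dist_triangle (u := x) (v := b') (w := y)
  have h4 := hG.dist_triangle (u := a) (v := b') (w := y)
  have h5 := hG.dist_triangle (u := a) (v := y) (w := b)
  have h6 := G.dist_comm (u := b') (v := y)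
  exact ⟨b, hb, by omega⟩

/-! ### Trees from parent maps -/

/-- The graph that joins every vertex to its parent. -/
def parentGraph {W : Type u} (par : W → W) : SimpleGraph W where
  Adj w w' := w ≠ w' ∧ (par w = w' ∨ par w' = w)
  symm := ⟨fun _ _ h => ⟨h.1.symm, h.2.symm⟩⟩
  loopless := ⟨fun _ h => h.1 rfl⟩

theorem parentGraph_dist_le {W : Type u} (par : W → W) (w : W) :
    (parentGraph par).dist w (par w) ≤ 1 := by
  by_cases h : w = par w
  · rw [← h]; simp
  · exact le_of_eq (SimpleGraph.dist_eq_one_iff_adj.2 ⟨h, Or.inl rfl⟩)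

theorem parentGraph_isTree {W : Type u} (par : W → W) (lev : W → ℕ) (root : W)
    (h0 : ∀ w, lev w = 0 → w = root) (hlev : ∀ w, lev (par w) = lev w - 1) :
    (parentGraph par).IsTree := by
  have hreach : ∀ n w, lev w = n → (parentGraph par).Reachable w root := by
    intro n
    induction n with
    | zero => intro w hw; rw [h0 w hw]
    | succ n ih =>
      intro w hw
      have h1 := ih (par w) (by rw [hlev, hw]; rfl)
      have h2 : (parentGraph par).Adj w (par w) :=
        ⟨fun h => by have := hlev w; rw [← h] at this; omega, Or.inl rfl⟩
      exact h2.reachable.trans h1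
  have hpos : ∀ w, w ≠ par w → 0 < lev w := by
    intro w hw
    by_contra h
    have h1 : lev w = 0 := by omega
    have h2 : lev (par w) = 0 := by rw [hlev, h1]
    exact hw ((h0 _ h1).trans (h0 _ h2).symm)
  refine ⟨(SimpleGraph.connected_iff_exists_forall_reachable _).2
    ⟨root, fun w => (hreach _ w rfl).symm⟩, ?_⟩
  rw [SimpleGraph.isAcyclic_iff_forall_adj_isBridge]
  -- the descendants of `w` are cut off when the edge from `w` to its parent is removed
  have key : ∀ w, w ≠ par w → (parentGraph par).IsBridge s(w, par w) := by
    intro w hw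
    rw [SimpleGraph.isBridge_iff]
    intro hr
    obtain ⟨p⟩ := hr
    have hdesc : ∀ {x y : W} (_ : ((parentGraph par).deleteEdges {s(w, par w)}).Walk x y),
        (∃ k, par^[k] x = w) → ∃ k, par^[k] y = w := by
      intro x y p
      induction p with
      | nil => exact id
      | @cons x x' y hadj p ih =>
        rintro ⟨k, hk⟩
        apply ih
        rw [SimpleGraph.deleteEdges_adj] at hadj
        obtain ⟨⟨_, h | h⟩, hne⟩ := hadj
        · cases k with
          | zero =>
            simp only [Function.iterate_zero, id_eq] at hk
            subst hk; subst h
            simp at hne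
          | succ k => exact ⟨k, by rw [← h, ← Function.iterate_succ_apply]; exact hk⟩
        · exact ⟨k + 1, by rw [Function.iterate_succ_apply, h]; exact hk⟩
    obtain ⟨k, hk⟩ := hdesc p ⟨0, rfl⟩
    have hk' : ∀ k x, lev (par^[k] x) ≤ lev x := by
      intro k
      induction k with
      | zero => intro x; exact le_rfl
      | succ k ih =>
        intro x
        rw [Function.iterate_succ_apply]
        have := ih (par x)
        have := hlev x
        omega
    have h1 := hk' k (par w)
    rw [hk] at h1
    have h2 := hpos w hw
    have h3 := hlev w
    omega
  rintro w w' ⟨hne, rfl | rfl⟩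
  · exact key w hne
  · rw [Sym2.eq_swap]; exact key w' hne.symm

/-! ### The tree of components at increasing distance from a base point -/

theorem dist_le_mul_dist_of_adj {X : Type u} {Y : Type v} {G : SimpleGraph X} {H : SimpleGraph Y}
    (hG : G.Connected) (hH : H.Connected) (f : X → Y) (K : ℕ)
    (hf : ∀ x y, G.Adj x y → H.dist (f x) (f y) ≤ K) (x y : X) :
    H.dist (f x) (f y) ≤ K * G.dist x y := by
  have key : ∀ {x y : X} (p : G.Walk x y), H.dist (f x) (f y) ≤ K * p.length := by
    intro x y p
    induction p with
    | nil => simp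
    | @cons x y z h p ih =>
      have h1 := hH.dist_triangle (u := f x) (v := f y) (w := f z)
      have h2 := hf _ _ h
      rw [SimpleGraph.Walk.length_cons, mul_add, mul_one]
      omega
  obtain ⟨p, hp⟩ := hG.exists_walk_length_eq_dist x y
  rw [← hp]
  exact key p

/-- `x` and `y` are joined by a walk all of whose vertices have distance at least `3 n` from the
base point `s`. -/
def JoinedBeyond {X : Type u} (G : SimpleGraph X) (s : X) (n : ℕ) (x y : X) : Prop :=
  ∃ p : G.Walk x y, ∀ b ∈ p.support, 3 * n ≤ G.dist s b

theorem JoinedBeyond.symm {X : Type u} {G : SimpleGraph X} {s : X} {n : ℕ} {x y : X}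
    (h : JoinedBeyond G s n x y) : JoinedBeyond G s n y x := by
  obtain ⟨p, hp⟩ := h
  exact ⟨p.reverse, fun b hb => hp b (by simpa using hb)⟩

theorem JoinedBeyond.trans {X : Type u} {G : SimpleGraph X} {s : X} {n : ℕ} {x y z : X}
    (h : JoinedBeyond G s n x y) (h' : JoinedBeyond G s n y z) : JoinedBeyond G s n x z := by
  obtain ⟨p, hp⟩ := h
  obtain ⟨q, hq⟩ := h'
  exact ⟨p.append q, fun b hb => ((SimpleGraph.Walk.mem_support_append_iff _ _).1 hb).elim
    (hp b) (hq b)⟩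

theorem JoinedBeyond.mono {X : Type u} {G : SimpleGraph X} {s : X} {n m : ℕ} {x y : X}
    (h : JoinedBeyond G s n x y) (hm : m ≤ n) : JoinedBeyond G s m x y := by
  obtain ⟨p, hp⟩ := h
  exact ⟨p, fun b hb => le_trans (by omega) (hp b hb)⟩

theorem JoinedBeyond.refl {X : Type u} {G : SimpleGraph X} {s : X} {n : ℕ} {x : X}
    (h : 3 * n ≤ G.dist s x) : JoinedBeyond G s n x x :=
  ⟨SimpleGraph.Walk.nil, fun b hb => by
    rw [SimpleGraph.Walk.support_nil, List.mem_singleton] at hb; rwa [hb]⟩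

theorem joinedBeyond_of_adj {X : Type u} {G : SimpleGraph X} {s : X} {n : ℕ} {x y : X}
    (hxy : G.Adj x y) (hx : 3 * n ≤ G.dist s x) (hy : 3 * n ≤ G.dist s y) :
    JoinedBeyond G s n x y :=
  ⟨hxy.toWalk, fun b hb => by
    simp only [SimpleGraph.Walk.support_cons, SimpleGraph.Walk.support_nil, List.mem_cons,
      List.not_mem_nil, or_false] at hb
    rcases hb with rfl | rfl <;> assumption⟩

theorem joinedBeyond_of_geodesic {X : Type u} {G : SimpleGraph X} (hG : G.Connected) {s : X} {n : ℕ}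
    {a x : X} (ha : G.dist s a + G.dist a x = G.dist s x) (hn : 3 * n ≤ G.dist s a) :
    JoinedBeyond G s n a x := by
  obtain ⟨p, hp⟩ := hG.exists_walk_length_eq_dist a x
  refine ⟨p, fun b hb => ?_⟩
  have h1 := dist_add_dist_of_mem_geodesic hG p hp hb
  have h2 := hG.dist_triangle (u := s) (v := b) (w := x)
  omega

/-- Pairs of a level `n` and a vertex at distance at least `3 n + 1` from `s`, where two pairs of
the same level are equivalent if their vertices are joined by a walk that keeps distance at least
`3 n` from `s`. The requirement `3 n + 1` discards the components that end at distance `3 n`, and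
so excludes dead ends from the tree. -/
def layerSetoid {X : Type u} (G : SimpleGraph X) (s : X) :
    Setoid {p : ℕ × X // 3 * p.1 + 1 ≤ G.dist s p.2} where
  r p q := p.1.1 = q.1.1 ∧ JoinedBeyond G s p.1.1 p.1.2 q.1.2
  iseqv :=
    { refl := fun p => ⟨rfl, JoinedBeyond.refl (le_trans (Nat.le_succ _) p.2)⟩
      symm := fun h => ⟨h.1.symm, h.1 ▸ h.2.symm⟩
      trans := fun h h' => ⟨h.1.trans h'.1, h.2.trans (h.1 ▸ h'.2)⟩ }

/-- The vertices of the layer tree: those components of the complements of the balls of radius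
`3 n - 1` about `s`, for all `n`, that reach distance `3 n + 1` from `s`. -/
def Layer {X : Type u} (G : SimpleGraph X) (s : X) : Type u := Quotient (layerSetoid G s)

namespace Layer

variable {X : Type u} {G : SimpleGraph X} {s : X}

instance [Countable X] : Countable (Layer G s) :=
  inferInstanceAs (Countable (Quotient (layerSetoid G s)))

/-- The component of `x` at level `n`. -/
def mk (n : ℕ) (x : X) (h : 3 * n + 1 ≤ G.dist s x) : Layer G s :=
  Quotient.mk (layerSetoid G s) ⟨(n, x), h⟩

theorem mk_eq_mk {n m : ℕ} {x y : X} {h : 3 * n + 1 ≤ G.dist s x} {h' : 3 * m + 1 ≤ G.dist s y} :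
    mk n x h = mk m y h' ↔ n = m ∧ JoinedBeyond G s n x y :=
  Quotient.eq (r := layerSetoid G s)

/-- The level of a component. -/
def lev : Layer G s → ℕ :=
  Quotient.lift (fun p => p.1.1) fun _ _ h => h.1

/-- The component of the next lower level that contains a given one; a component of level `0` is
its own parent. -/
def par : Layer G s → Layer G s :=
  Quotient.lift (fun p => mk (p.1.1 - 1) p.1.2 (by have := p.2; omega)) fun p q h =>
    mk_eq_mk.2 ⟨by rw [h.1], h.2.mono (Nat.sub_le _ _)⟩

theorem lev_mk {n : ℕ} {x : X} (h : 3 * n + 1 ≤ G.dist s x) : lev (mk n x h) = n := rfl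

theorem par_mk {n : ℕ} {x : X} (h : 3 * n + 1 ≤ G.dist s x) :
    par (mk n x h) = mk (n - 1) x (by omega) := rfl

theorem exists_mk (w : Layer G s) : ∃ x, ∃ h : 3 * lev w + 1 ≤ G.dist s x, w = mk (lev w) x h := by
  obtain ⟨⟨⟨n, x⟩, h⟩, rfl⟩ := Quotient.exists_rep w
  exact ⟨x, h, rfl⟩

theorem exists_mk_dist_eq (hG : G.Connected) (w : Layer G s) :
    ∃ x, ∃ h : 3 * lev w + 1 ≤ G.dist s x, w = mk (lev w) x h ∧ G.dist s x = 3 * lev w + 1 := by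
  obtain ⟨x, h, hx⟩ := exists_mk w
  obtain ⟨a, ha, ha'⟩ := exists_dist_eq_on_geodesic hG s x h
  refine ⟨a, ha.ge, ?_, ha⟩
  conv_lhs => rw [hx]
  exact mk_eq_mk.2 ⟨rfl, (joinedBeyond_of_geodesic hG ha' (by omega)).symm⟩

theorem isTree (hG : G.Connected) {x₁ : X} (hx₁ : 1 ≤ G.dist s x₁) :
    (parentGraph (par : Layer G s → Layer G s)).IsTree := by
  refine parentGraph_isTree par lev (mk 0 x₁ hx₁) (fun w hw => ?_) (fun w => ?_)
  · obtain ⟨x, h, hx⟩ := exists_mk w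
    rw [hx]
    obtain ⟨p⟩ := hG.preconnected x x₁
    exact mk_eq_mk.2 ⟨hw, p, fun b _ => by rw [hw]; omega⟩
  · obtain ⟨x, h, hx⟩ := exists_mk w
    rw [hx, par_mk]; rfl

end Layer

/-- Under the bottleneck property, the points at distance `3 n + 1` from `s` in one component
beyond distance `3 n` are uniformly close to each other. -/
theorem HasBottleneck.dist_le_of_joinedBeyond {X : Type u} {G : SimpleGraph X} {c : ℕ}
    (hG : G.Connected) (hB : HasBottleneck G c) {s : X} {n : ℕ} {x y : X}
    (hx : G.dist s x = 3 * n + 1) (hy : G.dist s y = 3 * n + 1) (h : JoinedBeyond G s n x y) :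
    G.dist x y ≤ 4 * c + 4 := by
  by_cases hn : 3 * n + 1 < c + 2
  · have h1 := hG.dist_triangle (u := x) (v := s) (w := y)
    have h2 := G.dist_comm (u := x) (v := s)
    omega
  · -- the bottleneck `a` lies so deep that a walk beyond `3 n` stays out of its `c`-ball
    obtain ⟨a, ha, ha'⟩ := exists_dist_eq_on_geodesic hG s x (n := 3 * n + 1 - (c + 2)) (by omega)
    obtain ⟨q, hq⟩ := h
    obtain ⟨p, hp⟩ := hG.exists_walk_length_eq_dist s y
    obtain ⟨b, hb, hab⟩ := hB s x a ha' (p.append q.reverse)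
    have h1 := hG.dist_triangle (u := s) (v := a) (w := b)
    have h2 := hG.dist_triangle (u := s) (v := b) (w := a)
    have h3 := G.dist_comm (u := a) (v := b)
    rcases (SimpleGraph.Walk.mem_support_append_iff _ _).1 hb with hb | hb
    · have h4 := dist_add_dist_of_mem_geodesic hG p hp hb
      have h5 := hG.dist_triangle (u := x) (v := a) (w := b)
      have h6 := hG.dist_triangle (u := x) (v := b) (w := y)
      have h7 := G.dist_comm (u := x) (v := a)
      omega
    · have h4 := hq b (by simpa using hb)
      omega

/-- A graph with the bottleneck property is quasi-isometric to its layer tree. -/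
theorem HasBottleneck.quasiIsometric_layer {X : Type u} {G : SimpleGraph X} {c : ℕ}
    (hG : G.Connected) (hB : HasBottleneck G c) {s x₁ : X} (hx₁ : 1 ≤ G.dist s x₁) :
    QuasiIsometric G (parentGraph (Layer.par : Layer G s → Layer G s)) := by
  have hT := Layer.isTree hG hx₁
  have hTc := hT.1
  refine ⟨hG, hTc, ?_⟩
  -- a quasi-inverse: a point of each component, as close to `s` as possible
  choose ρ hρ hρw hρd using Layer.exists_mk_dist_eq (s := s) hG
  have hclose : ∀ (n : ℕ) (a x : X) (h : 3 * n + 1 ≤ G.dist s x), G.dist s a = 3 * n + 1 →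
      JoinedBeyond G s n a x → G.dist a (ρ (Layer.mk n x h)) ≤ 4 * c + 4 := by
    intro n a x h ha hj
    have h1 := hρw (Layer.mk n x h)
    have h2 := hρd (Layer.mk n x h)
    rw [Layer.lev_mk] at h2
    have h3 := Layer.mk_eq_mk.1 h1
    exact hB.dist_le_of_joinedBeyond hG ha h2 (hj.trans h3.2)
  have hpar : ∀ w : Layer G s, G.dist (ρ w) (ρ (Layer.par w)) ≤ 4 * c + 7 := by
    intro w
    by_cases hw : Layer.lev w = 0
    · obtain ⟨x, h, hx⟩ := Layer.exists_mk w
      have : Layer.par w = w := by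
        conv_lhs => rw [hx, Layer.par_mk]
        conv_rhs => rw [hx]
        exact Layer.mk_eq_mk.2 ⟨by omega, JoinedBeyond.refl (by omega)⟩
      rw [this]; simp
    · obtain ⟨a, ha, ha'⟩ := exists_dist_eq_on_geodesic hG s (ρ w) (n := 3 * (Layer.lev w - 1) + 1)
        (by rw [hρd]; omega)
      have h1 : Layer.par w = Layer.mk (Layer.lev w - 1) (ρ w) (by rw [hρd]; omega) := by
        conv_lhs => rw [hρw w]
        exact Layer.par_mk _
      have h2 := hclose _ a (ρ w) (by rw [hρd]; omega) ha
        (joinedBeyond_of_geodesic hG ha' (by omega))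
      rw [← h1] at h2
      have h3 := hG.dist_triangle (u := ρ w) (v := a) (w := ρ (Layer.par w))
      have h4 := G.dist_comm (u := ρ w) (v := a)
      have h5 := hρd w
      omega
  have hρlip := dist_le_mul_dist_of_adj hTc hG ρ (4 * c + 7) (fun w w' hw => by
    rcases hw.2 with h | h
    · rw [← h]; exact hpar w
    · rw [← h, G.dist_comm]; exact hpar w')
  classical
  let lv : X → ℕ := fun x => (G.dist s x - 1) / 3
  let f : X → Layer G s := fun x =>
    if h : 1 ≤ G.dist s x then Layer.mk (lv x) x (by
      have := Nat.div_mul_le_self (G.dist s x - 1) 3; dsimp only [lv]; omega)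
    else Layer.mk 0 x₁ hx₁
  have hlv : ∀ x, 3 * lv x ≤ G.dist s x ∧ G.dist s x ≤ 3 * lv x + 3 := by
    intro x; dsimp only [lv]; omega
  have hfx : ∀ (x : X) (h : 3 * lv x + 1 ≤ G.dist s x), f x = Layer.mk (lv x) x h := by
    intro x h
    dsimp only [f]
    rw [dif_pos (by omega)]
  have hf0 : ∀ (x : X), G.dist s x = 0 → f x = Layer.mk 0 x₁ hx₁ := by
    intro x h
    dsimp only [f]
    rw [dif_neg (by omega)]
  have hroot : ∀ x (h : 1 ≤ G.dist s x), Layer.mk 0 x h = Layer.mk 0 x₁ hx₁ := by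
    intro x h
    obtain ⟨p⟩ := hG.preconnected x x₁
    exact Layer.mk_eq_mk.2 ⟨rfl, p, fun b _ => by omega⟩
  have hfadj : ∀ x y, G.Adj x y →
      (parentGraph (Layer.par : Layer G s → Layer G s)).dist (f x) (f y) ≤ 1 := by
    intro x y hxy
    have main : ∀ x y, G.Adj x y → lv x ≤ lv y →
        (parentGraph (Layer.par : Layer G s → Layer G s)).dist (f x) (f y) ≤ 1 := by
      intro x y hxy hle
      have hd := hxy.diff_dist_adj (u := s)
      have hlx : lv y ≤ lv x + 1 := by dsimp only [lv]; omega
      have hy' : 1 ≤ G.dist s y → 3 * lv x + 1 ≤ G.dist s y := by dsimp only [lv] at hle ⊢; omega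
      have hfy : ∀ h : 1 ≤ G.dist s y, f x = Layer.mk (lv x) y (hy' h) := by
        intro h
        by_cases hx : G.dist s x = 0
        · rw [hf0 x hx, ← hroot y h]
          congr 1
          dsimp only [lv]; omega
        · rw [hfx x (by dsimp only [lv]; omega)]
          refine Layer.mk_eq_mk.2 ⟨rfl, joinedBeyond_of_adj hxy (hlv x).1 ?_⟩
          have := hlv y; omega
      by_cases hy : G.dist s y = 0
      · have h0 : lv x = 0 := by dsimp only [lv]; omega
        have hx1 : 1 ≤ G.dist s x := by
          by_contra hx
          have hs : s = x := (hG.dist_eq_zero_iff).1 (by omega)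
          have hs' : s = y := (hG.dist_eq_zero_iff).1 hy
          exact hxy.ne (hs.symm.trans hs')
        rw [hf0 y hy, hfx x (by omega)]
        have : Layer.mk (lv x) x (by omega) = (Layer.mk 0 x₁ hx₁ : Layer G s) := by
          rw [← hroot x hx1]; congr 1
        rw [this]; simp
      · rw [hfy (by omega), hfx y (by dsimp only [lv]; omega)]
        by_cases he : lv x = lv y
        · have : Layer.mk (lv x) y (hy' (by omega)) =
              (Layer.mk (lv y) y (by dsimp only [lv]; omega) : Layer G s) := by
            congr 1
          rw [this]; simp
        · have h1 := parentGraph_dist_le (Layer.par : Layer G s → Layer G s)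
            (Layer.mk (lv y) y (by dsimp only [lv]; omega))
          rw [Layer.par_mk, SimpleGraph.dist_comm] at h1
          convert h1 using 3
          omega
    rcases le_total (lv x) (lv y) with h | h
    · exact main x y hxy h
    · rw [SimpleGraph.dist_comm]; exact main y x hxy.symm h
  have hflip := dist_le_mul_dist_of_adj hG hTc f 1 hfadj
  have hρf : ∀ x, G.dist x (ρ (f x)) ≤ 4 * c + 7 := by
    intro x
    by_cases hx : G.dist s x = 0
    · have hs : s = x := (hG.dist_eq_zero_iff).1 hx
      have h1 := hρd (f x)
      rw [hf0 x hx, Layer.lev_mk] at h1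
      rw [hf0 x hx, ← hs]
      omega
    · rw [hfx x (by dsimp only [lv]; omega)]
      obtain ⟨a, ha, ha'⟩ := exists_dist_eq_on_geodesic hG s x (n := 3 * lv x + 1)
        (by dsimp only [lv]; omega)
      have h2 := hclose _ a x (by dsimp only [lv]; omega) ha
        (joinedBeyond_of_geodesic hG ha' (by omega))
      have h3 := hG.dist_triangle (u := x) (v := a) (w := ρ (Layer.mk (lv x) x
        (by dsimp only [lv]; omega)))
      have h4 := G.dist_comm (u := x) (v := a)
      have h5 := hlv x
      omega
  refine ⟨f, ((4 * c + 7 : ℕ) : ℝ), 2, by exact_mod_cast Nat.le_add_left _ _, by norm_num,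
    fun x z => ⟨?_, ?_⟩, fun w => ⟨ρ w, ?_⟩⟩
  · have h1 := hρlip (f x) (f z)
    have h2 := hρf x
    have h3 := hρf z
    have h4 := hG.dist_triangle (u := x) (v := ρ (f x)) (w := z)
    have h5 := hG.dist_triangle (u := ρ (f x)) (v := ρ (f z)) (w := z)
    have h6 := G.dist_comm (u := z) (v := ρ (f z))
    have h7 : G.dist x z ≤ (4 * c + 7) *
        ((parentGraph (Layer.par : Layer G s → Layer G s)).dist (f x) (f z) + 2) := by
      rw [mul_add]; omega
    have h8 : graphDist G x z ≤ ((4 * c + 7 : ℕ) : ℝ) *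
        (graphDist (parentGraph (Layer.par : Layer G s → Layer G s)) (f x) (f z) + 2) := by
      unfold graphDist; exact_mod_cast h7
    have hpos : (0 : ℝ) < ((4 * c + 7 : ℕ) : ℝ) := by positivity
    rw [sub_le_iff_le_add, one_div, inv_mul_le_iff₀ hpos]
    exact h8
  · have h1 := hflip x z
    have h2 : (parentGraph (Layer.par : Layer G s → Layer G s)).dist (f x) (f z) ≤
        (4 * c + 7) * G.dist x z + 2 := by nlinarith
    unfold graphDist; exact_mod_cast h2
  · have h1 : f (ρ w) = w := by
      have hl : lv (ρ w) = Layer.lev w := by dsimp only [lv]; rw [hρd]; omega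
      rw [hfx (ρ w) (by rw [hl]; exact hρ w)]
      conv_rhs => rw [hρw w]
      congr 1
    rw [h1]
    simp [graphDist]

/-! ### Branching and regularity of the layer tree -/

/-- Around every vertex `y` there are, arbitrarily far from `y`, infinitely many vertices that are
pairwise separated by the closed unit ball about `y`. -/
def HasBranching {X : Type u} (G : SimpleGraph X) : Prop :=
  ∀ (y : X) (N : ℕ), ∃ t : ℕ → X, (∀ m, N ≤ G.dist y (t m)) ∧
    ∀ m m', m ≠ m' → ∀ p : G.Walk (t m) (t m'), ∃ b ∈ p.support, G.dist y b ≤ 1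

/-- Branching gives every vertex of the layer tree infinitely many children: far points `t m`
that the unit ball about `y` separates from the base point and from each other lie in distinct
components of the next level, and are reached from `y` without coming back towards `s`. -/
theorem HasBranching.infinite_neighborSet {X : Type u} {G : SimpleGraph X} (hG : G.Connected)
    (hE : HasBranching G) {s : X} (w : Layer G s) :
    ((parentGraph (Layer.par : Layer G s → Layer G s)).neighborSet w).Infinite := by
  obtain ⟨y, hy, hwy, hyd⟩ := Layer.exists_mk_dist_eq hG w
  set n := Layer.lev w with hn
  obtain ⟨t, htfar, htsep⟩ := hE y 5
  have hball : ∀ b, G.dist y b ≤ 1 → 3 * n ≤ G.dist s b ∧ G.dist s b ≤ 3 * n + 2 := by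
    intro b hb
    have h1 := hG.dist_triangle (u := s) (v := y) (w := b)
    have h2 := hG.dist_triangle (u := s) (v := b) (w := y)
    have h3 := G.dist_comm (u := b) (v := y)
    omega
  let good : Set ℕ := {m | ∀ p : G.Walk s (t m), ∃ b ∈ p.support, G.dist y b ≤ 1}
  have hgood : good.Infinite := by
    refine Set.Finite.infinite_compl (s := goodᶜ) ?_ |>.mono (by rw [compl_compl])
    refine Set.Subsingleton.finite fun m hm m' hm' => ?_
    by_contra hne
    simp only [good, Set.mem_compl_iff, Set.mem_ofPred_eq, not_forall] at hm hm'
    obtain ⟨p, hp⟩ := hm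
    obtain ⟨q, hq⟩ := hm'
    obtain ⟨b, hb, hyb⟩ := htsep m m' hne (p.reverse.append q)
    rcases (SimpleGraph.Walk.mem_support_append_iff _ _).1 hb with hb | hb
    · exact hp ⟨b, by simpa using hb, hyb⟩
    · exact hq ⟨b, hb, hyb⟩
  have hfar : ∀ m ∈ good, 3 * (n + 1) + 1 ≤ G.dist s (t m) := by
    intro m hm
    obtain ⟨p, hp⟩ := hG.exists_walk_length_eq_dist s (t m)
    obtain ⟨b, hb, hyb⟩ := hm p
    have h1 := dist_add_dist_of_mem_geodesic hG p hp hb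
    have h2 := hball b hyb
    have h3 := htfar m
    have h4 := hG.dist_triangle (u := y) (v := b) (w := t m)
    omega
  have hjoin : ∀ m ∈ good, JoinedBeyond G s n y (t m) := by
    intro m hm
    classical
    obtain ⟨p, hp⟩ := hG.exists_walk_length_eq_dist y (t m)
    refine ⟨p, fun q hq => ?_⟩
    by_contra hlt
    obtain ⟨r, hr⟩ := hG.exists_walk_length_eq_dist s q
    have hp' : (p.dropUntil q hq).length = G.dist q (t m) := by
      have h1 := SimpleGraph.dist_le (p.takeUntil q hq)
      have h2 := SimpleGraph.dist_le (p.dropUntil q hq)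
      have h3 := congrArg SimpleGraph.Walk.length (p.take_spec hq)
      rw [SimpleGraph.Walk.length_append] at h3
      have h4 := hG.dist_triangle (u := y) (v := q) (w := t m)
      omega
    obtain ⟨b, hb, hyb⟩ := hm (r.append (p.dropUntil q hq))
    have h1 := hball b hyb
    rcases (SimpleGraph.Walk.mem_support_append_iff _ _).1 hb with hb | hb
    · have h2 := dist_add_dist_of_mem_geodesic hG r hr hb
      omega
    · have h2 := dist_add_dist_of_mem_geodesic hG _ hp' hb
      have h3 := dist_add_dist_of_mem_geodesic hG p hp hq
      have h4 := hG.dist_triangle (u := y) (v := b) (w := t m)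
      have h5 := hball q (by omega)
      omega
  have := hgood.to_subtype
  refine Set.infinite_of_injective_forall_mem
    (f := fun m : good => (Layer.mk (n + 1) (t m) (hfar m m.2) : Layer G s)) ?_ ?_
  · rintro ⟨m, hm⟩ ⟨m', hm'⟩ h
    by_contra hne
    obtain ⟨p, hp⟩ := (Layer.mk_eq_mk.1 h).2
    obtain ⟨b, hb, hyb⟩ := htsep m m' (fun h => hne (Subtype.ext h)) p
    have h1 := hball b hyb
    have h2 := hp b hb
    omega
  · rintro ⟨m, hm⟩
    have hpar : Layer.par (Layer.mk (n + 1) (t m) (hfar m hm)) = w := by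
      rw [Layer.par_mk, hwy]
      exact Layer.mk_eq_mk.2 ⟨rfl, (hjoin m hm).symm⟩
    refine ⟨fun h => ?_, Or.inr hpar⟩
    have h1 := congrArg Layer.lev h
    rw [Layer.lev_mk, ← hn] at h1
    omega

theorem HasBranching.isCountablyRegularTree {X : Type u} [Countable X] {G : SimpleGraph X}
    (hG : G.Connected) (hE : HasBranching G) {s x₁ : X} (hx₁ : 1 ≤ G.dist s x₁) :
    IsCountablyRegularTree (parentGraph (Layer.par : Layer G s → Layer G s)) :=
  ⟨Layer.isTree hG hx₁, fun w => ⟨Set.to_countable _, hE.infinite_neighborSet hG w⟩⟩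

/-! ### Transport of quasi-isometries, and bounded graphs -/

theorem dist_map_le {X : Type u} {Y : Type v} {G : SimpleGraph X} {H : SimpleGraph Y}
    (hG : G.Connected) (f : G →g H) (x y : X) : H.dist (f x) (f y) ≤ G.dist x y := by
  obtain ⟨p, hp⟩ := hG.exists_walk_length_eq_dist x y
  rw [← hp, ← SimpleGraph.Walk.length_map f p]
  exact SimpleGraph.dist_le _

theorem dist_map_iso {X : Type u} {Y : Type v} {G : SimpleGraph X} {H : SimpleGraph Y}
    (hG : G.Connected) (e : G ≃g H) (x y : X) : H.dist (e x) (e y) = G.dist x y := by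
  refine le_antisymm (dist_map_le hG e.toHom x y) ?_
  have h := dist_map_le (e.connected_iff.1 hG) e.symm.toHom (e x) (e y)
  have h1 : e.symm.toHom (e x) = x := e.symm_apply_apply x
  have h2 : e.symm.toHom (e y) = y := e.symm_apply_apply y
  rwa [h1, h2] at h

theorem QuasiIsometric.trans_iso {X : Type u} {Y : Type v} {Z : Type w} {G : SimpleGraph X}
    {T : SimpleGraph Y} {T' : SimpleGraph Z} (h : QuasiIsometric G T) (e : T ≃g T') :
    QuasiIsometric G T' := by
  obtain ⟨hG, hT, f, K, C, hK, hC, h1, h2⟩ := h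
  have hd : ∀ x y, graphDist T' (e x) (e y) = graphDist T x y := fun x y => by
    unfold graphDist; rw [dist_map_iso hT e]
  refine ⟨hG, e.connected_iff.1 hT, fun x => e (f x), K, C, hK, hC, fun x z => ?_, fun y => ?_⟩
  · rw [hd]; exact h1 x z
  · obtain ⟨x, hx⟩ := h2 (e.symm y)
    refine ⟨x, ?_⟩
    have := hd (f x) (e.symm y)
    rw [e.apply_symm_apply] at this
    rwa [this]

theorem IsCountablyRegularTree.of_iso {Y : Type v} {Z : Type w} {T : SimpleGraph Y}
    {T' : SimpleGraph Z} (h : IsCountablyRegularTree T) (e : T ≃g T') :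
    IsCountablyRegularTree T' := by
  refine ⟨e.isTree_iff.1 h.1, fun z => ?_⟩
  have h1 := h.2 (e.symm z)
  have h2 : T'.neighborSet z = e '' T.neighborSet (e.symm z) := by
    ext z'
    simp only [SimpleGraph.mem_neighborSet, Set.mem_image]
    constructor
    · intro hz
      exact ⟨e.symm z', e.symm.map_adj_iff.2 hz, e.apply_symm_apply z'⟩
    · rintro ⟨y, hy, rfl⟩
      have := e.map_adj_iff.2 hy
      rwa [e.apply_symm_apply] at this
  rw [h2]
  exact ⟨h1.1.image _, h1.2.image e.injective.injOn⟩

/-- A countable tree in any universe can be replaced by an isomorphic one whose vertices are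
natural numbers. -/
theorem exists_type_zero_countablyRegularTree {X : Type u} {Y : Type v} [Countable Y]
    {G : SimpleGraph X} {T : SimpleGraph Y} (hT : IsCountablyRegularTree T)
    (h : QuasiIsometric G T) :
    ∃ (W : Type) (T' : SimpleGraph W), IsCountablyRegularTree T' ∧ QuasiIsometric G T' := by
  obtain ⟨φ, hφ⟩ := exists_injective_nat Y
  let i : Y ≃ Set.range φ := Equiv.ofInjective φ hφ
  let e : T ≃g T.comap i.symm := (SimpleGraph.Iso.comap i.symm T).symm
  exact ⟨Set.range φ, T.comap i.symm, hT.of_iso e, h.trans_iso e⟩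

theorem quasiIsometric_bot_of_dist_le {X : Type u} {G : SimpleGraph X} (hG : G.Connected) (C : ℕ)
    (h : ∀ x y, G.dist x y ≤ C) : QuasiIsometric G (⊥ : SimpleGraph PUnit.{v + 1}) := by
  refine ⟨hG, (SimpleGraph.IsTree.of_subsingleton).1, fun _ => PUnit.unit, 1, C, le_rfl,
    by positivity, fun x z => ?_, fun y => ?_⟩
  · have h1 : (G.dist x z : ℝ) ≤ C := by exact_mod_cast h x z
    have h2 : (0 : ℝ) ≤ G.dist x z := by positivity
    constructor
    · simpa [graphDist] using h1
    · simp only [graphDist, SimpleGraph.dist_self, Nat.cast_zero]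
      positivity
  · obtain ⟨x⟩ := hG.nonempty
    exact ⟨x, by simp [graphDist]⟩

theorem isQuasiTree_of_dist_le {X : Type u} {G : SimpleGraph X} (hG : G.Connected) (C : ℕ)
    (h : ∀ x y, G.dist x y ≤ C) : IsQuasiTree G :=
  ⟨PUnit.{u + 1}, ⊥, SimpleGraph.IsTree.of_subsingleton, quasiIsometric_bot_of_dist_le hG C h⟩

/-! ### Words and homomorphisms of a right-angled Artin group -/

namespace RAAG

variable {V : Type u} {Γ : SimpleGraph V}

theorem commute_gen {a b : V} (h : Γ.Adj a b) : Commute (gen Γ a) (gen Γ b) := by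
  have h1 : PresentedGroup.mk {r : FreeGroup V | ∃ a b : V, Γ.Adj a b ∧
      r = FreeGroup.of a * FreeGroup.of b * (FreeGroup.of a)⁻¹ * (FreeGroup.of b)⁻¹}
      (FreeGroup.of a * FreeGroup.of b * (FreeGroup.of a)⁻¹ * (FreeGroup.of b)⁻¹) = 1 :=
    PresentedGroup.one_of_mem ⟨a, b, h, rfl⟩
  simp only [map_mul, map_inv] at h1
  change gen Γ a * gen Γ b * (gen Γ a)⁻¹ * (gen Γ b)⁻¹ = 1 at h1
  rw [mul_inv_eq_one, mul_inv_eq_iff_eq_mul] at h1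
  exact h1

/-- The homomorphism out of `A(Γ)` given by images of the generators that commute along edges. -/
def lift {H : Type v} [Group H] (f : V → H) (hf : ∀ a b, Γ.Adj a b → Commute (f a) (f b)) :
    RAAG Γ →* H :=
  PresentedGroup.toGroup (f := f) (by
    rintro r ⟨a, b, hab, rfl⟩
    simp only [map_mul, map_inv, FreeGroup.lift_apply_of]
    rw [mul_inv_eq_one, mul_inv_eq_iff_eq_mul]
    exact hf a b hab)

@[simp] theorem lift_gen {H : Type v} [Group H] (f : V → H)
    (hf : ∀ a b, Γ.Adj a b → Commute (f a) (f b)) (a : V) : lift f hf (gen Γ a) = f a :=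
  PresentedGroup.toGroup.of _

/-- The element of `A(Γ)` spelled by a word in the generators (`true`) and their inverses
(`false`). -/
def val (Γ : SimpleGraph V) (l : List (V × Bool)) : RAAG Γ :=
  PresentedGroup.mk _ (FreeGroup.mk l)

theorem exists_val_eq (g : RAAG Γ) : ∃ l, val Γ l = g := by
  obtain ⟨x, rfl⟩ := PresentedGroup.mk_surjective _ g
  obtain ⟨l, rfl⟩ := Quot.exists_rep x
  exact ⟨l, rfl⟩

theorem val_append (l l' : List (V × Bool)) : val Γ (l ++ l') = val Γ l * val Γ l' := by
  unfold val
  rw [← FreeGroup.mul_mk, map_mul]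

theorem val_nil : val Γ [] = 1 := by
  unfold val
  rw [← FreeGroup.one_eq_mk, map_one]

theorem val_invRev (l : List (V × Bool)) : val Γ (FreeGroup.invRev l) = (val Γ l)⁻¹ := by
  unfold val
  rw [← FreeGroup.inv_mk, map_inv]

theorem val_true (a : V) : val Γ [(a, true)] = gen Γ a := rfl

theorem val_false (a : V) : val Γ [(a, false)] = (gen Γ a)⁻¹ := by
  rw [← val_true, ← val_invRev]; rfl

theorem induction_left {P : RAAG Γ → Prop} (one : P 1) (mul : ∀ a h, P h → P (gen Γ a * h))
    (inv_mul : ∀ a h, P h → P ((gen Γ a)⁻¹ * h)) (g : RAAG Γ) : P g := by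
  obtain ⟨l, rfl⟩ := exists_val_eq g
  induction l with
  | nil => rw [val_nil]; exact one
  | cons x l ih =>
    have h : val Γ (x :: l) = val Γ [x] * val Γ l := val_append [x] l
    rw [h]
    obtain ⟨a, _ | _⟩ := x
    · rw [val_false]; exact inv_mul a _ ih
    · rw [val_true]; exact mul a _ ih

/-- The homomorphism to `ℤ` that counts the exponents of the generator `a`. -/
noncomputable def exponent (Γ : SimpleGraph V) (a : V) : RAAG Γ →* Multiplicative ℤ :=
  open Classical in
  lift (fun b => if b = a then Multiplicative.ofAdd 1 else 1) fun _ _ _ => Commute.all _ _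

theorem exponent_gen_self (a : V) : exponent Γ a (gen Γ a) = Multiplicative.ofAdd 1 := by
  simp [exponent]

theorem exponent_gen_of_ne {a b : V} (h : b ≠ a) : exponent Γ a (gen Γ b) = 1 := by
  simp [exponent, h]

theorem ofAdd_one_ne_one : (Multiplicative.ofAdd (1 : ℤ)) ≠ 1 := by decide

theorem exponent_conj (a : V) (x g : RAAG Γ) :
    exponent Γ a (g⁻¹ * x * g) = exponent Γ a x := by
  rw [map_mul, map_mul, map_inv, mul_assoc, mul_comm, mul_assoc, mul_inv_cancel, mul_one]

theorem eq_of_conj_gen_eq {a b : V} {g h : RAAG Γ}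
    (e : g⁻¹ * gen Γ a * g = h⁻¹ * gen Γ b * h) : a = b := by
  have h1 := congrArg (exponent Γ b) e
  rw [exponent_conj, exponent_conj, exponent_gen_self] at h1
  by_contra hne
  rw [exponent_gen_of_ne hne] at h1
  exact ofAdd_one_ne_one h1.symm

/-- The subgroup generated by the star of `a`. -/
def star (Γ : SimpleGraph V) (a : V) : Subgroup (RAAG Γ) :=
  Subgroup.closure (gen Γ '' {b | b = a ∨ Γ.Adj a b})

theorem gen_mem_star {a b : V} (h : b = a ∨ Γ.Adj a b) : gen Γ b ∈ star Γ a :=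
  Subgroup.subset_closure ⟨b, h, rfl⟩

theorem commute_of_mem_star {a : V} {g : RAAG Γ} (hg : g ∈ star Γ a) : Commute (gen Γ a) g := by
  have h : star Γ a ≤ Subgroup.centralizer {gen Γ a} := by
    refine (Subgroup.closure_le _).2 ?_
    rintro _ ⟨b, rfl | hb, rfl⟩
    · exact Subgroup.mem_centralizer_singleton_iff.2 rfl
    · exact Subgroup.mem_centralizer_singleton_iff.2 (commute_gen hb).symm
  exact (Subgroup.mem_centralizer_singleton_iff.1 (h hg)).symm

theorem exponent_of_mem_star {a b : V} (h : ¬ (b = a ∨ Γ.Adj a b)) {g : RAAG Γ}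
    (hg : g ∈ star Γ a) : exponent Γ b g = 1 := by
  have h1 : star Γ a ≤ (exponent Γ b).ker := by
    refine (Subgroup.closure_le _).2 ?_
    rintro _ ⟨c, hc, rfl⟩
    exact exponent_gen_of_ne (fun e => h (e ▸ hc))
  exact h1 hg

/-- The retraction of `A(Γ)` onto the subgroup generated by the star of `a` that kills the other
generators. -/
noncomputable def retract (Γ : SimpleGraph V) (a : V) : RAAG Γ →* RAAG Γ :=
  open Classical in
  lift (fun b => if b = a ∨ Γ.Adj a b then gen Γ b else 1) (by
    intro b c hbc
    split_ifs
    · exact commute_gen hbc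
    · exact Commute.one_right _
    · exact Commute.one_left _
    · exact Commute.one_left _)

theorem retract_of_mem_star {a : V} {g : RAAG Γ} (hg : g ∈ star Γ a) : retract Γ a g = g := by
  have h1 : star Γ a ≤ (retract Γ a).eqLocus (MonoidHom.id _) := by
    refine (Subgroup.closure_le _).2 ?_
    rintro _ ⟨c, hc, rfl⟩
    have hc' : c = a ∨ Γ.Adj a c := hc
    show retract Γ a (gen Γ c) = gen Γ c
    simp [retract, hc']
  exact h1 hg

theorem retract_mem_star (a : V) (g : RAAG Γ) : retract Γ a g ∈ star Γ a := by
  have hgen : ∀ b, retract Γ a (gen Γ b) ∈ star Γ a := by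
    intro b
    by_cases hb : b = a ∨ Γ.Adj a b
    · rw [retract_of_mem_star (gen_mem_star hb)]; exact gen_mem_star hb
    · simp [retract, hb]
  induction g using induction_left with
  | one => rw [map_one]; exact one_mem _
  | mul b h ih => rw [map_mul]; exact mul_mem (hgen b) ih
  | inv_mul b h ih => rw [map_mul, map_inv]; exact mul_mem (inv_mem (hgen b)) ih

/-! ### The crossing number -/

open Classical in
/-- The change of the crossing number when `g` is multiplied by the generator `b` on the left. -/
noncomputable def crossingWeight (Γ : SimpleGraph V) (a b : V) (g : RAAG Γ) : ℤ :=
  if b = a ∧ g ∈ star Γ a then 1 else 0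

/-- The permutation of `A(Γ) × ℤ` that multiplies the first coordinate by the generator `b`, and
adds `1` to the second coordinate if `b = a` and the first coordinate lies in the subgroup
generated by the star of `a`. -/
noncomputable def crossingPerm (Γ : SimpleGraph V) (a b : V) : Equiv.Perm (RAAG Γ × ℤ) where
  toFun p := (gen Γ b * p.1, p.2 + crossingWeight Γ a b p.1)
  invFun p := ((gen Γ b)⁻¹ * p.1, p.2 - crossingWeight Γ a b ((gen Γ b)⁻¹ * p.1))
  left_inv p := by simp
  right_inv p := by simp

theorem gen_mul_mem_star {a b : V} (h : b = a ∨ Γ.Adj a b) {g : RAAG Γ} :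
    gen Γ b * g ∈ star Γ a ↔ g ∈ star Γ a :=
  Subgroup.mul_mem_cancel_left _ (gen_mem_star h)

theorem crossingPerm_commute (a : V) {b c : V} (h : Γ.Adj b c) :
    Commute (crossingPerm Γ a b) (crossingPerm Γ a c) := by
  classical
  refine Equiv.ext fun p => ?_
  have hbc : gen Γ b * (gen Γ c * p.1) = gen Γ c * (gen Γ b * p.1) := by
    rw [← mul_assoc, ← mul_assoc, (commute_gen h).eq]
  simp only [crossingPerm, Equiv.Perm.mul_apply, Equiv.coe_fn_mk]
  refine Prod.ext hbc ?_
  by_cases hb : b = a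
  · have hc : c ≠ a := fun hc => h.ne (hb.trans hc.symm)
    subst hb
    simp [crossingWeight, hc, gen_mul_mem_star (Or.inr h)]
  · by_cases hc : c = a
    · subst hc
      simp [crossingWeight, hb, gen_mul_mem_star (Or.inr h.symm)]
    · simp [crossingWeight, hb, hc]

/-- The action of `A(Γ)` on `A(Γ) × ℤ` by the permutations `crossingPerm`. -/
noncomputable def crossingAction (Γ : SimpleGraph V) (a : V) :
    RAAG Γ →* Equiv.Perm (RAAG Γ × ℤ) :=
  lift (crossingPerm Γ a) fun _ _ h => crossingPerm_commute a h

theorem crossingAction_fst (a : V) (g : RAAG Γ) (p : RAAG Γ × ℤ) :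
    (crossingAction Γ a g p).1 = g * p.1 := by
  induction g using induction_left with
  | one => simp
  | mul b h ih =>
    rw [map_mul, Equiv.Perm.mul_apply, mul_assoc, ← ih]
    simp [crossingAction, crossingPerm]
  | inv_mul b h ih =>
    rw [map_mul, Equiv.Perm.mul_apply, mul_assoc, ← ih, map_inv]
    simp only [crossingAction, lift_gen]
    rfl

/-- The crossing number of `g` with respect to the generator `a`: spelling `g` from right to left,
the signed number of letters `a` or `a⁻¹` that are multiplied to an element of the subgroup
generated by the star of `a`. Geometrically, these letters cross those translates of the
hyperplane of `a` that meet the axis of `a` through `1`, and the crossing number is the coordinate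
of the projection of `g` to this axis. -/
noncomputable def crossing (Γ : SimpleGraph V) (a : V) (g : RAAG Γ) : ℤ :=
  (crossingAction Γ a g (1, 0)).2

theorem crossing_one (a : V) : crossing Γ a 1 = 0 := by simp [crossing]

theorem crossingAction_eq (a : V) (g : RAAG Γ) :
    crossingAction Γ a g (1, 0) = (g, crossing Γ a g) :=
  Prod.ext (by rw [crossingAction_fst, mul_one]) rfl

theorem crossing_gen_mul_of_ne {a b : V} (h : b ≠ a) (g : RAAG Γ) :
    crossing Γ a (gen Γ b * g) = crossing Γ a g := by
  conv_lhs => unfold crossing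
  rw [map_mul, Equiv.Perm.mul_apply, crossingAction_eq]
  simp [crossingAction, crossingPerm, crossingWeight, h]

theorem crossing_gen_mul_of_mem (a : V) {g : RAAG Γ} (h : g ∈ star Γ a) :
    crossing Γ a (gen Γ a * g) = crossing Γ a g + 1 := by
  conv_lhs => unfold crossing
  rw [map_mul, Equiv.Perm.mul_apply, crossingAction_eq]
  simp [crossingAction, crossingPerm, crossingWeight, h]

theorem crossing_gen_mul_of_notMem (a : V) {g : RAAG Γ} (h : g ∉ star Γ a) :
    crossing Γ a (gen Γ a * g) = crossing Γ a g := by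
  conv_lhs => unfold crossing
  rw [map_mul, Equiv.Perm.mul_apply, crossingAction_eq]
  simp [crossingAction, crossingPerm, crossingWeight, h]

/-- A letter `b` changes the crossing number only if `b = a` and the letter is multiplied to an
element of the subgroup generated by the star of `a`. -/
theorem crossing_gen_mul_of_not {a b : V} {g : RAAG Γ} (h : ¬ (b = a ∧ g ∈ star Γ a)) :
    crossing Γ a (gen Γ b * g) = crossing Γ a g := by
  by_cases hb : b = a
  · subst hb
    exact crossing_gen_mul_of_notMem b fun hg => h ⟨rfl, hg⟩
  · exact crossing_gen_mul_of_ne hb g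

theorem inv_gen_mul_mem_star {a : V} {g : RAAG Γ} :
    (gen Γ a)⁻¹ * g ∈ star Γ a ↔ g ∈ star Γ a :=
  Subgroup.mul_mem_cancel_left _ (inv_mem (gen_mem_star (Or.inl rfl)))

theorem crossing_inv_gen_mul_of_not {a b : V} {g : RAAG Γ} (h : ¬ (b = a ∧ g ∈ star Γ a)) :
    crossing Γ a ((gen Γ b)⁻¹ * g) = crossing Γ a g := by
  have h1 := crossing_gen_mul_of_not (a := a) (b := b) (g := (gen Γ b)⁻¹ * g) (by
    rintro ⟨rfl, h2⟩
    exact h ⟨rfl, inv_gen_mul_mem_star.1 h2⟩)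
  rw [mul_inv_cancel_left] at h1
  exact h1.symm

theorem crossing_inv_gen_mul_of_mem (a : V) {g : RAAG Γ} (h : g ∈ star Γ a) :
    crossing Γ a ((gen Γ a)⁻¹ * g) = crossing Γ a g - 1 := by
  have h1 := crossing_gen_mul_of_mem a (inv_gen_mul_mem_star.2 h)
  rw [mul_inv_cancel_left] at h1
  omega

theorem crossing_mul_gen (a : V) (g : RAAG Γ) :
    crossing Γ a (g * gen Γ a) = crossing Γ a g + 1 := by
  have hmem : ∀ h : RAAG Γ, h * gen Γ a ∈ star Γ a ↔ h ∈ star Γ a := fun h =>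
    Subgroup.mul_mem_cancel_right _ (gen_mem_star (Or.inl rfl))
  induction g using induction_left with
  | one =>
    have h1 := crossing_gen_mul_of_mem a (one_mem (star Γ a))
    rw [one_mul]
    rwa [mul_one] at h1
  | mul b h ih =>
    rw [mul_assoc]
    by_cases hb : b = a ∧ h ∈ star Γ a
    · obtain ⟨rfl, hh⟩ := hb
      rw [crossing_gen_mul_of_mem b ((hmem h).2 hh), crossing_gen_mul_of_mem b hh, ih]
    · rw [crossing_gen_mul_of_not hb, crossing_gen_mul_of_not (by rwa [hmem]), ih]
  | inv_mul b h ih =>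
    rw [mul_assoc]
    by_cases hb : b = a ∧ h ∈ star Γ a
    · obtain ⟨rfl, hh⟩ := hb
      rw [crossing_inv_gen_mul_of_mem b ((hmem h).2 hh), crossing_inv_gen_mul_of_mem b hh, ih]
      omega
    · rw [crossing_inv_gen_mul_of_not hb, crossing_inv_gen_mul_of_not (by rwa [hmem]), ih]

theorem crossing_mul_inv_gen (a : V) (g : RAAG Γ) :
    crossing Γ a (g * (gen Γ a)⁻¹) = crossing Γ a g - 1 := by
  have h := crossing_mul_gen a (g * (gen Γ a)⁻¹)
  rw [inv_mul_cancel_right] at h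
  omega

theorem crossing_mul_gen_pow (a : V) (g : RAAG Γ) (m : ℕ) :
    crossing Γ a (g * gen Γ a ^ m) = crossing Γ a g + m := by
  induction m with
  | zero => simp
  | succ m ih =>
    rw [pow_succ, ← mul_assoc, crossing_mul_gen, ih]
    push_cast; ring

/-! ### Centralizers and commuting conjugates of generators -/

/-- The centralizer of a generator is generated by its star: if `a g = g a`, then multiplying `g`
by `a` on the left changes its crossing number, as multiplying it on the right does. -/
theorem mem_star_iff_commute {a : V} {g : RAAG Γ} : g ∈ star Γ a ↔ Commute (gen Γ a) g := by
  refine ⟨commute_of_mem_star, fun h => ?_⟩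
  by_contra hg
  have h1 := crossing_gen_mul_of_notMem a hg
  rw [h.eq, crossing_mul_gen] at h1
  omega

theorem commute_gen_iff {a b : V} : Commute (gen Γ a) (gen Γ b) ↔ b = a ∨ Γ.Adj a b := by
  refine ⟨fun h => ?_, fun h => commute_of_mem_star (gen_mem_star h)⟩
  by_contra hn
  have h1 := exponent_of_mem_star hn (mem_star_iff_commute.2 h)
  rw [exponent_gen_self] at h1
  exact ofAdd_one_ne_one h1

theorem commute_conj_iff {x y g : RAAG Γ} :
    Commute (g⁻¹ * x * g) (g⁻¹ * y * g) ↔ Commute x y := by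
  have h := Commute.conj_iff (a := x) (b := y) g⁻¹
  rwa [inv_inv] at h

/-- Two commuting conjugates of generators are simultaneously conjugate to commuting
generators. -/
theorem exists_common_conj {a b : V} {g h : RAAG Γ}
    (hc : Commute (g⁻¹ * gen Γ a * g) (h⁻¹ * gen Γ b * h)) :
    (b = a ∨ Γ.Adj a b) ∧ ∃ k : RAAG Γ, g⁻¹ * gen Γ a * g = k⁻¹ * gen Γ a * k ∧
      h⁻¹ * gen Γ b * h = k⁻¹ * gen Γ b * k := by
  have e : h⁻¹ * gen Γ b * h = g⁻¹ * ((h * g⁻¹)⁻¹ * gen Γ b * (h * g⁻¹)) * g := by group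
  rw [e, commute_conj_iff, ← mem_star_iff_commute] at hc
  have hb : b = a ∨ Γ.Adj a b := by
    by_contra hn
    have h1 := exponent_of_mem_star hn hc
    rw [exponent_conj, exponent_gen_self] at h1
    exact ofAdd_one_ne_one h1
  refine ⟨hb, retract Γ a (h * g⁻¹) * g, ?_, ?_⟩
  · have h1 := (commute_of_mem_star (retract_mem_star a (h * g⁻¹))).eq
    have h2 : (retract Γ a (h * g⁻¹))⁻¹ * gen Γ a * retract Γ a (h * g⁻¹) = gen Γ a := by
      rw [mul_assoc, h1, inv_mul_cancel_left]
    rw [mul_inv_rev]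
    conv_lhs => rw [← h2]
    group
  · have h1 := retract_of_mem_star hc
    rw [map_mul, map_mul, map_inv, retract_of_mem_star (gen_mem_star hb)] at h1
    rw [e, ← h1, mul_inv_rev]
    group

/-! ### Connectedness of the extension graph -/

/-- The vertex `g⁻¹ a g` of the extension graph. -/
def conjVertex (Γ : SimpleGraph V) (a : V) (g : RAAG Γ) : ExtensionVertex Γ :=
  ⟨g⁻¹ * gen Γ a * g, a, g, rfl⟩

theorem exists_eq_conjVertex (x : ExtensionVertex Γ) : ∃ a g, x = conjVertex Γ a g := by
  obtain ⟨x, a, g, rfl⟩ := x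
  exact ⟨a, g, rfl⟩

theorem conjVertex_adj {a b : V} (h : Γ.Adj a b) (g : RAAG Γ) :
    (extensionGraph Γ).Adj (conjVertex Γ a g) (conjVertex Γ b g) :=
  ⟨fun e => h.ne (eq_of_conj_gen_eq (congrArg Subtype.val e)), commute_conj_iff.2 (commute_gen h)⟩

/-- The copy of `Γ` in its extension graph that consists of the generators conjugated by `g`. -/
def pieceHom (Γ : SimpleGraph V) (g : RAAG Γ) : Γ →g extensionGraph Γ where
  toFun a := conjVertex Γ a g
  map_rel' h := conjVertex_adj h g

theorem conj_mul_of_commute {a : V} {s : RAAG Γ} (hs : Commute (gen Γ a) s) (g : RAAG Γ) :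
    (s * g)⁻¹ * gen Γ a * (s * g) = g⁻¹ * gen Γ a * g := by
  have h : s⁻¹ * gen Γ a * s = gen Γ a := by rw [mul_assoc, hs.eq, inv_mul_cancel_left]
  conv_rhs => rw [← h]
  group

theorem conjVertex_mul_of_commute {a : V} {s : RAAG Γ} (hs : Commute (gen Γ a) s) (g : RAAG Γ) :
    conjVertex Γ a (s * g) = conjVertex Γ a g :=
  Subtype.ext (conj_mul_of_commute hs g)

theorem commute_gen_val_singleton (a : V) (ε : Bool) : Commute (gen Γ a) (val Γ [(a, ε)]) := by
  cases ε
  · rw [val_false]; exact (Commute.refl _).inv_right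
  · exact Commute.refl _

theorem extensionGraph_connected (hΓ : Γ.Connected) : (extensionGraph Γ).Connected := by
  have hpiece : ∀ (a b : V) (g : RAAG Γ),
      (extensionGraph Γ).Reachable (conjVertex Γ a g) (conjVertex Γ b g) := fun a b g =>
    (hΓ.preconnected a b).map (pieceHom Γ g)
  have hstep : ∀ (a b c : V) (s g : RAAG Γ), Commute (gen Γ c) s →
      (extensionGraph Γ).Reachable (conjVertex Γ a g) (conjVertex Γ b (s * g)) := by
    intro a b c s g hs
    have h := hpiece a c g
    rw [← conjVertex_mul_of_commute hs g] at h
    exact h.trans (hpiece c b (s * g))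
  obtain ⟨a⟩ := hΓ.nonempty
  refine (SimpleGraph.connected_iff_exists_forall_reachable _).2 ⟨conjVertex Γ a 1, fun x => ?_⟩
  obtain ⟨b, g, rfl⟩ := exists_eq_conjVertex x
  have key : (extensionGraph Γ).Reachable (conjVertex Γ a 1) (conjVertex Γ a g) := by
    induction g using induction_left with
    | one => exact SimpleGraph.Reachable.refl _
    | mul c h ih => exact ih.trans (hstep a a c _ h (Commute.refl _))
    | inv_mul c h ih => exact ih.trans (hstep a a c _ h (Commute.refl _).inv_right)
  exact key.trans (hpiece a b g)

theorem dist_le_one_of_commute {x y : ExtensionVertex Γ} (h : Commute x.1 y.1) :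
    (extensionGraph Γ).dist x y ≤ 1 := by
  by_cases e : x = y
  · rw [e]; simp
  · exact le_of_eq (SimpleGraph.dist_eq_one_iff_adj.2 ⟨e, h⟩)

/-! ### Stars of vertices separate the extension graph -/

/-- The elements that conjugate a generator to a given vertex which does not commute with
`k⁻¹ v k` all have the same crossing number relative to `k⁻¹ v k`. -/
theorem crossing_eq_of_conj_eq {a v : V} {g g' k : RAAG Γ}
    (e : g⁻¹ * gen Γ a * g = g'⁻¹ * gen Γ a * g')
    (hn : ¬ Commute (g⁻¹ * gen Γ a * g) (k⁻¹ * gen Γ v * k)) :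
    crossing Γ v (g * k⁻¹) = crossing Γ v (g' * k⁻¹) := by
  have hbad : ∀ b, (b = a ∨ Γ.Adj a b) → ∀ y ∈ star Γ a,
      ¬ (b = v ∧ y * (g * k⁻¹) ∈ star Γ v) := by
    rintro b hb y hy ⟨rfl, hm⟩
    apply hn
    have h1 : g⁻¹ * gen Γ a * g = (y * (g * k⁻¹) * k)⁻¹ * gen Γ a * (y * (g * k⁻¹) * k) := by
      rw [← conj_mul_of_commute (commute_of_mem_star hy) g]
      group
    have h2 := conj_mul_of_commute (commute_of_mem_star hm) k
    rw [h1, ← h2, commute_conj_iff]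
    exact commute_gen_iff.2 hb
  have key : ∀ s ∈ star Γ a, crossing Γ v (s * (g * k⁻¹)) = crossing Γ v (g * k⁻¹) := by
    intro s hs
    induction hs using Subgroup.closure_induction_left with
    | one => rw [one_mul]
    | mul_left x hx y hy ih =>
      obtain ⟨b, hb, rfl⟩ := hx
      rw [mul_assoc, crossing_gen_mul_of_not (hbad b hb y hy), ih]
    | inv_mul_cancel x hx y hy ih =>
      obtain ⟨b, hb, rfl⟩ := hx
      rw [mul_assoc, crossing_inv_gen_mul_of_not (hbad b hb y hy), ih]
  have hs : g' * g⁻¹ ∈ star Γ a := by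
    rw [mem_star_iff_commute]
    have h1 : gen Γ a = g'* (g⁻¹ * gen Γ a * g) * g'⁻¹ := by rw [e]; group
    change gen Γ a * (g' * g⁻¹) = g' * g⁻¹ * gen Γ a
    conv_lhs => rw [h1]
    group
  have h2 := key _ hs
  rw [← h2]
  congr 1
  group

/-- The star of `k⁻¹ v k` separates the vertices of the extension graph according to the crossing
number relative to `k⁻¹ v k`. -/
theorem exists_commute_of_crossing_ne {v : V} {k : RAAG Γ} {x z : ExtensionVertex Γ}
    (p : (extensionGraph Γ).Walk x z) {a b : V} {g g' : RAAG Γ} (hx : x = conjVertex Γ a g)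
    (hz : z = conjVertex Γ b g') (hne : crossing Γ v (g * k⁻¹) ≠ crossing Γ v (g' * k⁻¹)) :
    ∃ y ∈ p.support, Commute (conjVertex Γ v k).1 y.1 := by
  by_contra hcon
  push Not at hcon
  apply hne
  clear hne
  induction p generalizing a g with
  | nil =>
    have h1 : g⁻¹ * gen Γ a * g = g'⁻¹ * gen Γ b * g' := congrArg Subtype.val (hx.symm.trans hz)
    have hab := eq_of_conj_gen_eq h1
    subst hab
    refine crossing_eq_of_conj_eq h1 fun h => ?_
    have := hcon _ (List.mem_singleton_self _)
    rw [hx] at this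
    exact this h.symm
  | @cons x y z hxy p ih =>
    obtain ⟨c, h, rfl⟩ := exists_eq_conjVertex y
    have hc := hxy.2
    rw [hx] at hc
    obtain ⟨-, u, hu, hu'⟩ := exists_common_conj hc
    have hx' := hcon x (by simp)
    rw [hx] at hx'
    have h1 := crossing_eq_of_conj_eq hu fun h => hx' h.symm
    rw [h1]
    refine ih (a := c) (Subtype.ext hu') hz fun y hy => hcon y (by
      rw [SimpleGraph.Walk.support_cons]; exact List.mem_cons_of_mem _ hy)

/-! ### Reduced words and the bottleneck property -/

/-- A word is reduced if no shorter word spells the same element of `A(Γ)`. -/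
def IsReduced (Γ : SimpleGraph V) (l : List (V × Bool)) : Prop :=
  ∀ l', val Γ l' = val Γ l → l.length ≤ l'.length

theorem exists_isReduced (g : RAAG Γ) : ∃ l, val Γ l = g ∧ IsReduced Γ l := by
  classical
  have hex : ∃ n, ∃ l, val Γ l = g ∧ l.length = n := by
    obtain ⟨l, hl⟩ := exists_val_eq g
    exact ⟨_, l, hl, rfl⟩
  obtain ⟨l, hl, hn⟩ := Nat.find_spec hex
  exact ⟨l, hl, fun l' hl' => hn ▸ Nat.find_min' hex ⟨l', hl'.trans hl, rfl⟩⟩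

theorem IsReduced.left {p q : List (V × Bool)} (h : IsReduced Γ (p ++ q)) : IsReduced Γ p := by
  intro p' hp'
  have h1 := h (p' ++ q) (by rw [val_append, val_append, hp'])
  rw [List.length_append, List.length_append] at h1
  omega

theorem IsReduced.right {p q : List (V × Bool)} (h : IsReduced Γ (p ++ q)) : IsReduced Γ q := by
  intro q' hq'
  have h1 := h (p ++ q') (by rw [val_append, val_append, hq'])
  rw [List.length_append, List.length_append] at h1
  omega

theorem IsReduced.invRev {p : List (V × Bool)} (h : IsReduced Γ p) :
    IsReduced Γ (FreeGroup.invRev p) := by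
  intro q hq
  have h1 := h (FreeGroup.invRev q) (by rw [val_invRev, hq, val_invRev, inv_inv])
  rw [FreeGroup.invRev_length] at h1 ⊢
  exact h1

/-- The exponent of a letter. -/
def sgn (ε : Bool) : ℤ := if ε then 1 else -1

theorem crossing_mul_val_singleton (v : V) (ε : Bool) (g : RAAG Γ) :
    crossing Γ v (g * val Γ [(v, ε)]) = crossing Γ v g + sgn ε := by
  cases ε
  · rw [val_false, crossing_mul_inv_gen]; simp [sgn, sub_eq_add_neg]
  · rw [val_true, crossing_mul_gen]; simp [sgn]

theorem val_cons (x : V × Bool) (l : List (V × Bool)) : val Γ (x :: l) = val Γ [x] * val Γ l :=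
  val_append [x] l

theorem crossing_val_cons_of_mem {v : V} (ε : Bool) {q : List (V × Bool)}
    (h : val Γ q ∈ star Γ v) :
    crossing Γ v (val Γ ((v, ε) :: q)) = crossing Γ v (val Γ q) + sgn ε := by
  rw [val_cons]
  cases ε
  · rw [val_false, crossing_inv_gen_mul_of_mem v h]; simp [sgn, sub_eq_add_neg]
  · rw [val_true, crossing_gen_mul_of_mem v h]; simp [sgn]

theorem crossing_val_cons_of_not {u v : V} (ε : Bool) {q : List (V × Bool)}
    (h : ¬ (u = v ∧ val Γ q ∈ star Γ v)) :
    crossing Γ v (val Γ ((u, ε) :: q)) = crossing Γ v (val Γ q) := by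
  rw [val_cons]
  cases ε
  · rw [val_false, crossing_inv_gen_mul_of_not h]
  · rw [val_true, crossing_gen_mul_of_not h]

/-- If a letter of `q` crosses in the direction opposite to a final letter `v^ε`, then the word
between these two letters commutes with `v`, both letters can be cancelled, and the word was not
reduced. -/
theorem IsReduced.crossing_nonneg {v : V} {ε : Bool} {q : List (V × Bool)}
    (h : IsReduced Γ (q ++ [(v, ε)])) : 0 ≤ sgn ε * crossing Γ v (val Γ q) := by
  induction q with
  | nil => rw [val_nil, crossing_one, mul_zero]
  | cons x q ih =>
    obtain ⟨u, η⟩ := x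
    have ih' := ih (IsReduced.right (p := [(u, η)]) h)
    by_cases hu : u = v ∧ val Γ q ∈ star Γ v
    · obtain ⟨rfl, hq⟩ := hu
      rw [crossing_val_cons_of_mem η hq]
      by_cases hη : η = ε
      · subst hη
        rw [mul_add]
        cases η <;> simp [sgn] at ih' ⊢ <;> omega
      · exfalso
        have h1 : val Γ q = val Γ ((u, η) :: q ++ [(u, ε)]) := by
          have h2 := commute_of_mem_star hq
          rw [val_append, val_cons]
          cases η <;> cases ε
          · exact absurd rfl hη
          · rw [val_false, val_true, mul_assoc, ← h2.eq, inv_mul_cancel_left]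
          · rw [val_false, val_true, h2.eq, mul_inv_cancel_right]
          · exact absurd rfl hη
        have h3 := h q h1
        simp at h3
    · rw [crossing_val_cons_of_not η hu]
      exact ih'

/-- Along a reduced word, the star of the conjugated generator at each letter separates the two
ends. -/
theorem IsReduced.exists_commute {v : V} {ε : Bool} {p q : List (V × Bool)}
    (h : IsReduced Γ (p ++ (v, ε) :: q)) {a b : V} {g : RAAG Γ}
    (w : (extensionGraph Γ).Walk (conjVertex Γ a g)
      (conjVertex Γ b (val Γ (p ++ (v, ε) :: q) * g))) :
    ∃ y ∈ w.support, Commute (conjVertex Γ v (val Γ q * g)).1 y.1 := by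
  refine exists_commute_of_crossing_ne w rfl rfl ?_
  have h1 : 0 ≤ sgn ε * crossing Γ v (val Γ p) := by
    refine IsReduced.crossing_nonneg (IsReduced.left (q := q) ?_)
    rwa [List.append_assoc, List.singleton_append]
  have h2 : 0 ≤ sgn (!ε) * crossing Γ v (val Γ q)⁻¹ := by
    rw [← val_invRev]
    refine IsReduced.crossing_nonneg ?_
    have h3 := (IsReduced.right h).invRev
    rwa [FreeGroup.invRev_cons] at h3
  have e1 : g * (val Γ q * g)⁻¹ = (val Γ q)⁻¹ := by group
  have e2 : val Γ (p ++ (v, ε) :: q) * g * (val Γ q * g)⁻¹ = val Γ p * val Γ [(v, ε)] := by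
    rw [val_append, val_cons]; group
  rw [e1, e2, crossing_mul_val_singleton]
  cases ε <;> simp [sgn] at h1 h2 ⊢ <;> omega

theorem exists_hasBottleneck [Finite V] (hΓ : Γ.Connected) :
    ∃ c, HasBottleneck (extensionGraph Γ) c := by
  have hG := extensionGraph_connected hΓ
  obtain ⟨D, hD⟩ : ∃ D, ∀ a b, Γ.dist a b ≤ D := by
    obtain ⟨D, hD⟩ := (Set.finite_range fun p : V × V => Γ.dist p.1 p.2).bddAbove
    exact ⟨D, fun a b => hD ⟨(a, b), rfl⟩⟩
  have hpiece : ∀ (a b : V) (g : RAAG Γ),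
      (extensionGraph Γ).dist (conjVertex Γ a g) (conjVertex Γ b g) ≤ D := fun a b g =>
    (dist_map_le hΓ (pieceHom Γ g) a b).trans (hD a b)
  refine ⟨D + 3, hasBottleneck_of_separators hG D fun x z r hr => ?_⟩
  obtain ⟨a, g, rfl⟩ := exists_eq_conjVertex x
  obtain ⟨b, h, rfl⟩ := exists_eq_conjVertex z
  obtain ⟨l, hl, hred⟩ := exists_isReduced (h * g⁻¹)
  have hh : h = val Γ l * g := by rw [hl, inv_mul_cancel_right]
  subst hh
  by_contra hcon
  push Not at hcon
  -- if no separator has distance about `r`, then all pieces along the word are closer than `r`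
  have key : ∀ q p, p ++ q = l → ∀ c,
      (extensionGraph Γ).dist (conjVertex Γ a g) (conjVertex Γ c (val Γ q * g)) < r := by
    intro q
    induction q with
    | nil =>
      intro p _ c
      rw [val_nil, one_mul]
      have h1 := hpiece a c g
      by_contra hlt
      obtain ⟨w, hw⟩ := hcon (conjVertex Γ a g) (by simp) (by simp; omega)
      have := hw _ w.start_mem_support
      simp at this
    | cons x q ih =>
      obtain ⟨v, ε⟩ := x
      intro p hp c
      have h1 := ih (p ++ [(v, ε)]) (by rw [← hp]; simp) v
      have h2 := hpiece v c (val Γ ((v, ε) :: q) * g)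
      have h3 : conjVertex Γ v (val Γ ((v, ε) :: q) * g) = conjVertex Γ v (val Γ q * g) := by
        rw [val_cons, mul_assoc, conjVertex_mul_of_commute (commute_gen_val_singleton v ε)]
      rw [h3] at h2
      have h4 := hG.dist_triangle (u := conjVertex Γ a g) (v := conjVertex Γ v (val Γ q * g))
        (w := conjVertex Γ c (val Γ ((v, ε) :: q) * g))
      by_contra hlt
      obtain ⟨w, hw⟩ := hcon (conjVertex Γ v (val Γ q * g)) (by omega) (by omega)
      subst hp
      obtain ⟨y, hy, hc⟩ := hred.exists_commute w
      have h5 := hw y hy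
      have h6 := dist_le_one_of_commute hc
      omega
  have := key l [] rfl b
  omega

/-! ### Branching of the extension graph -/

/-- Conjugation by `u`, as a map of the extension graph to itself. -/
def conjHom (Γ : SimpleGraph V) (u : RAAG Γ) : extensionGraph Γ →g extensionGraph Γ where
  toFun x := ⟨u⁻¹ * x.1 * u, by
    obtain ⟨a, g, h⟩ := x.2
    exact ⟨a, g * u, by rw [h]; group⟩⟩
  map_rel' := by
    rintro x y ⟨hne, hc⟩
    refine ⟨fun e => hne (Subtype.ext ?_), commute_conj_iff.2 hc⟩
    have h : u⁻¹ * x.1 * u = u⁻¹ * y.1 * u := congrArg Subtype.val e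
    exact mul_left_cancel (mul_right_cancel h)

theorem conjHom_conjVertex (a : V) (g u : RAAG Γ) :
    conjHom Γ u (conjVertex Γ a g) = conjVertex Γ a (g * u) := by
  refine Subtype.ext ?_
  change u⁻¹ * (g⁻¹ * gen Γ a * g) * u = (g * u)⁻¹ * gen Γ a * (g * u)
  group

/-- In an unbounded extension graph, the images of one far vertex under the powers of `y` are
separated from each other by the star of `y`. -/
theorem hasBranching_of_unbounded (hG : (extensionGraph Γ).Connected)
    (hunb : ∀ N, ∃ x y, N ≤ (extensionGraph Γ).dist x y) : HasBranching (extensionGraph Γ) := by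
  intro y N
  obtain ⟨v, k, rfl⟩ := exists_eq_conjVertex y
  obtain ⟨t₀, ht₀⟩ : ∃ t, N ≤ (extensionGraph Γ).dist (conjVertex Γ v k) t := by
    obtain ⟨x, z, hxz⟩ := hunb (2 * N)
    have h1 := hG.dist_triangle (u := x) (v := conjVertex Γ v k) (w := z)
    rw [SimpleGraph.dist_comm (u := x) (v := conjVertex Γ v k)] at h1
    by_cases hx : N ≤ (extensionGraph Γ).dist (conjVertex Γ v k) x
    · exact ⟨x, hx⟩
    · exact ⟨z, by omega⟩
  obtain ⟨b, g, rfl⟩ := exists_eq_conjVertex t₀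
  refine ⟨fun m => conjVertex Γ b (g * k⁻¹ * gen Γ v ^ m * k), fun m => ?_,
    fun m m' hne p => ?_⟩
  · have h1 := dist_map_le hG (conjHom Γ (k⁻¹ * (gen Γ v ^ m)⁻¹ * k)) (conjVertex Γ v k)
      (conjVertex Γ b (g * k⁻¹ * gen Γ v ^ m * k))
    rw [conjHom_conjVertex, conjHom_conjVertex] at h1
    have e1 : k * (k⁻¹ * (gen Γ v ^ m)⁻¹ * k) = (gen Γ v ^ m)⁻¹ * k := by group
    have e2 : g * k⁻¹ * gen Γ v ^ m * k * (k⁻¹ * (gen Γ v ^ m)⁻¹ * k) = g := by group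
    rw [e1, e2, conjVertex_mul_of_commute ((Commute.refl _).pow_right m).inv_right] at h1
    exact ht₀.trans h1
  · obtain ⟨y, hy, hc⟩ := exists_commute_of_crossing_ne (v := v) (k := k) p rfl rfl (by
      rw [mul_inv_cancel_right, mul_inv_cancel_right, crossing_mul_gen_pow, crossing_mul_gen_pow]
      intro h
      apply hne
      omega)
    exact ⟨y, hy, dist_le_one_of_commute hc⟩

/-! ### Unboundedness of the extension graph -/

theorem crossing_le_gen_mul (a b : V) (g : RAAG Γ) :
    crossing Γ a g ≤ crossing Γ a (gen Γ b * g) := by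
  by_cases h : b = a ∧ g ∈ star Γ a
  · obtain ⟨rfl, h⟩ := h
    rw [crossing_gen_mul_of_mem b h]; omega
  · rw [crossing_gen_mul_of_not h]

/-- The products `v (n - 1) ⋯ v 1 v 0` of the generators in a sequence. -/
def seqProd (Γ : SimpleGraph V) (v : ℕ → V) : ℕ → RAAG Γ
  | 0 => 1
  | n + 1 => gen Γ (v n) * seqProd Γ v n

/-- The vertex of the extension graph given by the `n`-th letter of a sequence of generators,
conjugated by the product of the letters before it. -/
def seqVertex (Γ : SimpleGraph V) (v : ℕ → V) (n : ℕ) : ExtensionVertex Γ :=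
  conjVertex Γ (v n) (seqProd Γ v n)

/-- As all letters of the sequence are positive, crossing numbers are monotone along it. -/
theorem exists_commute_seqVertex {v : ℕ → V} {i j l : ℕ} (hij : i ≤ j) (hjl : j ≤ l)
    (p : (extensionGraph Γ).Walk (seqVertex Γ v i) (seqVertex Γ v l)) :
    ∃ y ∈ p.support, Commute (seqVertex Γ v j).1 y.1 := by
  rcases hjl.eq_or_lt with rfl | hjl
  · exact ⟨_, p.end_mem_support, Commute.refl _⟩
  refine exists_commute_of_crossing_ne p rfl rfl (ne_of_lt ?_)
  have hmono : Monotone fun n => crossing Γ (v j) (seqProd Γ v n * (seqProd Γ v j)⁻¹) :=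
    monotone_nat_of_le_succ fun n => by
      change _ ≤ crossing Γ (v j) (gen Γ (v n) * seqProd Γ v n * (seqProd Γ v j)⁻¹)
      rw [mul_assoc]
      exact crossing_le_gen_mul _ _ _
  have h1 : crossing Γ (v j) (seqProd Γ v i * (seqProd Γ v j)⁻¹) ≤ 0 := by
    have h := hmono hij
    dsimp only at h
    rwa [mul_inv_cancel, crossing_one] at h
  have h2 : 1 ≤ crossing Γ (v j) (seqProd Γ v l * (seqProd Γ v j)⁻¹) := by
    have h : crossing Γ (v j) (gen Γ (v j) * seqProd Γ v j * (seqProd Γ v j)⁻¹) ≤ _ :=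
      hmono (Nat.succ_le_of_lt hjl)
    rw [mul_inv_cancel_right] at h
    have h3 := crossing_gen_mul_of_mem (v j) (one_mem (star Γ (v j)))
    rw [mul_one, crossing_one] at h3
    rwa [h3] at h
  omega

theorem exists_walk_of_commute {x y : ExtensionVertex Γ} (h : Commute x.1 y.1) :
    ∃ p : (extensionGraph Γ).Walk x y, ∀ b ∈ p.support, b = x ∨ b = y := by
  by_cases e : x = y
  · subst e
    exact ⟨SimpleGraph.Walk.nil, fun b hb => Or.inl (List.mem_singleton.1 hb)⟩
  · have hadj : (extensionGraph Γ).Adj x y := ⟨e, h⟩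
    exact ⟨hadj.toWalk, fun b hb => by simpa using hb⟩

theorem not_commute_seqVertex {v : ℕ → V} (hv : ∀ j, Γᶜ.Adj (v j) (v (j + 1))) {i j : ℕ}
    (hij : i < j) : ¬ Commute (seqVertex Γ v i).1 (seqVertex Γ v j).1 := by
  have hbase : ∀ i, ¬ Commute (seqVertex Γ v i).1 (seqVertex Γ v (i + 1)).1 := by
    intro i h
    have e : seqVertex Γ v i = conjVertex Γ (v i) (seqProd Γ v (i + 1)) :=
      (conjVertex_mul_of_commute (Commute.refl _) _).symm
    rw [e] at h
    have h1 := commute_gen_iff.1 (commute_conj_iff.1 h)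
    have h2 := (SimpleGraph.compl_adj _ _ _).1 (hv i)
    exact h1.elim (fun h => h2.1 h.symm) h2.2
  obtain ⟨n, rfl⟩ := Nat.exists_eq_add_of_lt hij
  clear hij
  induction n generalizing i with
  | zero => exact hbase i
  | succ n ih =>
    intro h
    obtain ⟨p, hp⟩ := exists_walk_of_commute h
    obtain ⟨y, hy, hc⟩ := exists_commute_seqVertex (j := i + 1) (by omega) (by omega) p
    rcases hp y hy with rfl | rfl
    · exact hbase i hc.symm
    · have e : i + (n + 1) + 1 = (i + 1) + n + 1 := by omega
      rw [e] at hc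
      exact ih hc

/-- A vertex that commutes with two members of the sequence is joined to both, and the path
through it has to meet the stars of all members in between. -/
theorem commute_seqVertex_of_between {v : ℕ → V} (hv : ∀ j, Γᶜ.Adj (v j) (v (j + 1)))
    {x : ExtensionVertex Γ} {i j l : ℕ} (hij : i ≤ j) (hjl : j ≤ l)
    (hi : Commute (seqVertex Γ v i).1 x.1) (hl : Commute (seqVertex Γ v l).1 x.1) :
    Commute (seqVertex Γ v j).1 x.1 := by
  rcases hij.eq_or_lt with rfl | hij'
  · exact hi
  rcases hjl.eq_or_lt with rfl | hjl'
  · exact hl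
  obtain ⟨p, hp⟩ := exists_walk_of_commute hi
  obtain ⟨q, hq⟩ := exists_walk_of_commute hl.symm
  obtain ⟨y, hy, hc⟩ := exists_commute_seqVertex hij hjl (p.append q)
  have h : y = seqVertex Γ v i ∨ y = x ∨ y = seqVertex Γ v l := by
    rcases (SimpleGraph.Walk.mem_support_append_iff _ _).1 hy with h | h
    · have := hp y h; tauto
    · have := hq y h; tauto
  rcases h with rfl | rfl | rfl
  · exact absurd hc.symm (not_commute_seqVertex hv hij')
  · exact hc
  · exact absurd hc (not_commute_seqVertex hv hjl')

/-- If the letters from the `i`-th to the `l`-th exhaust the generators, then a vertex commuting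
with the `i`-th and the `l`-th member of the sequence is conjugate to a central element, so that
the corresponding vertex of `Γ` is adjacent to all others. -/
theorem exists_dominating_vertex {v : ℕ → V} (hv : ∀ j, Γᶜ.Adj (v j) (v (j + 1)))
    {x : ExtensionVertex Γ} {i l : ℕ} (hcover : ∀ a, ∃ j, i ≤ j ∧ j ≤ l ∧ v j = a)
    (hi : Commute (seqVertex Γ v i).1 x.1) (hl : Commute (seqVertex Γ v l).1 x.1) :
    ∃ b, ∀ a, a = b ∨ Γ.Adj b a := by
  have hcomm : ∀ j, i ≤ j → j ≤ l →
      Commute (gen Γ (v j)) (seqProd Γ v j * x.1 * (seqProd Γ v j)⁻¹) := by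
    intro j hij hjl
    have h := commute_seqVertex_of_between hv hij hjl hi hl
    rw [← commute_conj_iff (g := seqProd Γ v j)]
    have e : (seqProd Γ v j)⁻¹ * (seqProd Γ v j * x.1 * (seqProd Γ v j)⁻¹) * seqProd Γ v j =
        x.1 := by group
    rw [e]
    exact h
  have hconst : ∀ n, i + n ≤ l → seqProd Γ v (i + n) * x.1 * (seqProd Γ v (i + n))⁻¹ =
      seqProd Γ v i * x.1 * (seqProd Γ v i)⁻¹ := by
    intro n
    induction n with
    | zero => intro _; rfl
    | succ n ih =>
      intro h
      rw [← ih (by omega)]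
      have h1 := (hcomm (i + n) (by omega) (by omega)).eq
      change gen Γ (v (i + n)) * seqProd Γ v (i + n) * x.1 *
        (gen Γ (v (i + n)) * seqProd Γ v (i + n))⁻¹ = _
      rw [mul_inv_rev, ← mul_assoc, mul_inv_eq_iff_eq_mul, ← h1]
      simp only [mul_assoc]
  obtain ⟨b, g, rfl⟩ := exists_eq_conjVertex x
  set u := g * (seqProd Γ v i)⁻¹ with hu
  have hgen : ∀ a, Commute (gen Γ a) (u⁻¹ * gen Γ b * u) := by
    intro a
    obtain ⟨j, hij, hjl, rfl⟩ := hcover a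
    have h1 := hcomm j hij hjl
    obtain ⟨n, rfl⟩ := Nat.exists_eq_add_of_le hij
    rw [hconst n hjl] at h1
    convert h1 using 1
    rw [hu]
    change _ = seqProd Γ v i * (g⁻¹ * gen Γ b * g) * (seqProd Γ v i)⁻¹
    group
  have hall : ∀ h : RAAG Γ, Commute h (u⁻¹ * gen Γ b * u) := by
    intro h
    induction h using induction_left with
    | one => exact Commute.one_left _
    | mul a h ih => exact (hgen a).mul_left ih
    | inv_mul a h ih => exact (hgen a).inv_left.mul_left ih
  have hb : u⁻¹ * gen Γ b * u = gen Γ b := by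
    have h1 := (hall u).eq
    have h2 : u * (u⁻¹ * gen Γ b * u) = gen Γ b * u := by group
    rw [h2] at h1
    exact (mul_right_cancel h1).symm
  rw [hb] at hgen
  exact ⟨b, fun a => commute_gen_iff.1 (hgen a).symm⟩

/-- A finite connected graph with at least two vertices has a periodic infinite walk that visits
all vertices in each period. -/
theorem exists_periodic_covering {G : SimpleGraph V} [Finite V] [Nontrivial V]
    (hG : G.Preconnected) : ∃ (v : ℕ → V) (L : ℕ), (∀ j, G.Adj (v j) (v (j + 1))) ∧
      ∀ k a, ∃ j, k * L ≤ j ∧ j < (k + 1) * L ∧ v j = a := by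
  classical
  obtain ⟨a, b, hab⟩ := exists_pair_ne V
  have hex : ∀ s : Finset V, ∃ p : G.Walk a a, ∀ x ∈ s, x ∈ p.support := by
    intro s
    induction s using Finset.induction_on with
    | empty => exact ⟨SimpleGraph.Walk.nil, by simp⟩
    | insert x s _ ih =>
      obtain ⟨p, hp⟩ := ih
      obtain ⟨q⟩ := hG a x
      refine ⟨p.append (q.append q.reverse), fun y hy => ?_⟩
      rw [SimpleGraph.Walk.mem_support_append_iff, SimpleGraph.Walk.mem_support_append_iff]
      rcases Finset.mem_insert.1 hy with rfl | hy
      · exact Or.inr (Or.inl q.end_mem_support)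
      · exact Or.inl (hp y hy)
  have := Fintype.ofFinite V
  obtain ⟨p, hp⟩ := hex Finset.univ
  have hL : 0 < p.length := by
    by_contra h
    have h0 : p.length = 0 := by omega
    have h1 := hp b (Finset.mem_univ b)
    have h2 : p.Nil := SimpleGraph.Walk.length_eq_zero_iff.1 h0
    rw [h2.eq_nil] at h1
    exact hab (List.mem_singleton.1 h1).symm
  refine ⟨fun j => p.getVert (j % p.length), p.length, fun j => ?_, fun k x => ?_⟩
  · have hlt := Nat.mod_lt j hL
    have h1 := p.adj_getVert_succ hlt
    have h2 : p.getVert ((j + 1) % p.length) = p.getVert (j % p.length + 1) := by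
      rw [← Nat.mod_add_mod]
      rcases (Nat.succ_le_of_lt hlt).eq_or_lt with h | h
      · rw [Nat.succ_eq_add_one] at h
        rw [h, Nat.mod_self, p.getVert_zero, p.getVert_length]
      · rw [Nat.mod_eq_of_lt h]
    simpa only [h2] using h1
  · obtain ⟨n, hn, hnL⟩ := SimpleGraph.Walk.mem_support_iff_exists_getVert.1
      (hp x (Finset.mem_univ x))
    have hshift : ∀ m < p.length, (k * p.length + m) % p.length = m := fun m hm => by
      rw [Nat.mul_comm, Nat.mul_add_mod, Nat.mod_eq_of_lt hm]
    rcases hnL.eq_or_lt with h | h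
    · refine ⟨k * p.length + 0, by omega, by rw [add_mul]; omega, ?_⟩
      dsimp only
      rw [hshift 0 hL, p.getVert_zero, ← hn, h, p.getVert_length]
    · refine ⟨k * p.length + n, by omega, by rw [add_mul]; omega, ?_⟩
      dsimp only
      rw [hshift n h, hn]

theorem extensionGraph_unbounded [Finite V] [Nontrivial V] (hΓ : Γ.Connected)
    (hc : Γᶜ.Preconnected) (N : ℕ) : ∃ x y, N ≤ (extensionGraph Γ).dist x y := by
  classical
  have hG := extensionGraph_connected hΓ
  obtain ⟨v, L, hv, hcov⟩ := exists_periodic_covering hc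
  refine ⟨seqVertex Γ v (0 * L), seqVertex Γ v (N * L), ?_⟩
  obtain ⟨p, hp⟩ := hG.exists_walk_length_eq_dist (seqVertex Γ v (0 * L)) (seqVertex Γ v (N * L))
  have hmeet : ∀ k : ℕ, k ≤ N → ∃ y ∈ p.support, Commute (seqVertex Γ v (k * L)).1 y.1 :=
    fun k hk => exists_commute_seqVertex (Nat.mul_le_mul_right L (Nat.zero_le k))
      (Nat.mul_le_mul_right L hk) p
  have : Nonempty (ExtensionVertex Γ) := hG.nonempty
  choose! f hf hfc using hmeet
  have hdisj : ∀ k k', k < k' → k' ≤ N → f k ≠ f k' := by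
    intro k k' hk hk' he
    have h2 := hfc k' hk'
    rw [← he] at h2
    obtain ⟨b, hb⟩ := exists_dominating_vertex hv (fun a => by
      obtain ⟨j, h3, h4, h5⟩ := hcov k a
      exact ⟨j, h3, h4.le.trans (Nat.mul_le_mul_right L hk), h5⟩) (hfc k (by omega)) h2
    obtain ⟨c, hbc⟩ := hc.exists_adj_of_nontrivial b
    have h3 := (SimpleGraph.compl_adj _ _ _).1 hbc
    exact (hb c).elim (fun h => h3.1 h.symm) h3.2
  have hcard : (Finset.range (N + 1)).card ≤ p.support.toFinset.card := by
    refine Finset.card_le_card_of_injOn f (fun k hk => ?_) fun k hk k' hk' he => ?_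
    · simp only [Finset.coe_range, Set.mem_Iio] at hk
      simpa using hf k (by omega)
    · simp only [Finset.coe_range, Set.mem_Iio] at hk hk'
      rcases lt_trichotomy k k' with h | h | h
      · exact absurd he (hdisj k k' h (by omega))
      · exact h
      · exact absurd he.symm (hdisj k' k h (by omega))
  have h1 := hcard.trans (List.toFinset_card_le _)
  rw [Finset.card_range, SimpleGraph.Walk.length_support] at h1
  omega

/-! ### Joins, and the one-vertex graph -/

theorem commute_of_mem_closure {B : Set V} (hB : ∀ u ∈ B, ∀ w ∉ B, Γ.Adj u w) {b : V} (hb : b ∉ B)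
    {y : RAAG Γ} (hy : y ∈ Subgroup.closure (gen Γ '' B)) : Commute (gen Γ b) y := by
  have h : Subgroup.closure (gen Γ '' B) ≤ Subgroup.centralizer {gen Γ b} := by
    refine (Subgroup.closure_le _).2 ?_
    rintro _ ⟨u, hu, rfl⟩
    exact Subgroup.mem_centralizer_singleton_iff.2 (commute_gen (hB u hu b hb))
  exact (Subgroup.mem_centralizer_singleton_iff.1 (h hy)).symm

theorem commute_conj_of_join {B : Set V} (hB : ∀ u ∈ B, ∀ w ∉ B, Γ.Adj u w) {u b : V} (hu : u ∈ B)
    (hb : b ∉ B) (g : RAAG Γ) : Commute (gen Γ b) (g⁻¹ * gen Γ u * g) := by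
  have hgen : ∀ a, ∀ y ∈ Subgroup.closure (gen Γ '' B),
      (gen Γ a)⁻¹ * y * gen Γ a ∈ Subgroup.closure (gen Γ '' B) ∧
      gen Γ a * y * (gen Γ a)⁻¹ ∈ Subgroup.closure (gen Γ '' B) := by
    intro a y hy
    by_cases ha : a ∈ B
    · have h : gen Γ a ∈ Subgroup.closure (gen Γ '' B) := Subgroup.subset_closure ⟨a, ha, rfl⟩
      exact ⟨mul_mem (mul_mem (inv_mem h) hy) h, mul_mem (mul_mem h hy) (inv_mem h)⟩
    · have h := commute_of_mem_closure hB ha hy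
      rw [h.eq, mul_inv_cancel_right, mul_assoc, ← h.eq, inv_mul_cancel_left]
      exact ⟨hy, hy⟩
  have key : ∀ y ∈ Subgroup.closure (gen Γ '' B), g⁻¹ * y * g ∈ Subgroup.closure (gen Γ '' B) := by
    induction g using induction_left with
    | one => intro y hy; simpa using hy
    | mul a h ih =>
      intro y hy
      have e : (gen Γ a * h)⁻¹ * y * (gen Γ a * h) = h⁻¹ * ((gen Γ a)⁻¹ * y * gen Γ a) * h := by
        group
      rw [e]
      exact ih _ (hgen a y hy).1
    | inv_mul a h ih =>
      intro y hy
      have e : ((gen Γ a)⁻¹ * h)⁻¹ * y * ((gen Γ a)⁻¹ * h) =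
          h⁻¹ * (gen Γ a * y * (gen Γ a)⁻¹) * h := by group
      rw [e]
      exact ih _ (hgen a y hy).2
  exact commute_of_mem_closure hB hb (key _ (Subgroup.subset_closure ⟨u, hu, rfl⟩))

theorem dist_le_four_of_join (hΓ : Γ.Connected) (hj : IsNontrivialJoin Γ)
    (x y : ExtensionVertex Γ) : (extensionGraph Γ).dist x y ≤ 4 := by
  have hG := extensionGraph_connected hΓ
  unfold IsNontrivialJoin SimpleGraph.Preconnected at hj
  push Not at hj
  obtain ⟨a, b, hab⟩ := hj
  let B : Set V := {u | Γᶜ.Reachable a u}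
  have hB : ∀ u ∈ B, ∀ w ∉ B, Γ.Adj u w := by
    intro u hu w hw
    by_contra hn
    have hne : u ≠ w := fun e => hw (e ▸ hu)
    exact hw (SimpleGraph.Reachable.trans hu ((SimpleGraph.compl_adj _ _ _).2 ⟨hne, hn⟩).reachable)
  have hB' : ∀ u ∈ Bᶜ, ∀ w ∉ Bᶜ, Γ.Adj u w := fun u hu w hw =>
    (hB w (not_not.1 hw) u hu).symm
  have ha : a ∈ B := SimpleGraph.Reachable.refl a
  have hb : b ∉ B := hab
  have hone : ∀ (c u : V) (g : RAAG Γ), Commute (gen Γ c) (g⁻¹ * gen Γ u * g) →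
      (extensionGraph Γ).dist (conjVertex Γ c 1) (conjVertex Γ u g) ≤ 1 := by
    intro c u g h
    refine dist_le_one_of_commute ?_
    change Commute (1⁻¹ * gen Γ c * 1) (g⁻¹ * gen Γ u * g)
    simpa using h
  have htwo : ∀ x, (extensionGraph Γ).dist (conjVertex Γ a 1) x ≤ 2 := by
    intro x
    obtain ⟨u, g, rfl⟩ := exists_eq_conjVertex x
    by_cases hu : u ∈ B
    · have h1 := hone b u g (commute_conj_of_join hB hu hb g)
      have h2 := hone a b 1 (by simpa using commute_gen (hB a ha b hb))
      have h3 := hG.dist_triangle (u := conjVertex Γ a 1) (v := conjVertex Γ b 1)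
        (w := conjVertex Γ u g)
      omega
    · exact (hone a u g (commute_conj_of_join hB' hu (not_not.2 ha) g)).trans (by norm_num)
  have h1 := hG.dist_triangle (u := x) (v := conjVertex Γ a 1) (w := y)
  rw [SimpleGraph.dist_comm (u := x) (v := conjVertex Γ a 1)] at h1
  have h2 := htwo x
  have h3 := htwo y
  omega

theorem dist_eq_zero_of_subsingleton [Subsingleton V] (x y : ExtensionVertex Γ) :
    (extensionGraph Γ).dist x y = 0 := by
  have hcomm : ∀ (a : V) (g : RAAG Γ), Commute (gen Γ a) g := by
    intro a g
    induction g using induction_left with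
    | one => exact Commute.one_right _
    | mul b h ih =>
      obtain rfl := Subsingleton.elim a b
      exact (Commute.refl _).mul_right ih
    | inv_mul b h ih =>
      obtain rfl := Subsingleton.elim a b
      exact (Commute.refl _).inv_right.mul_right ih
  have heq : ∀ (a : V) (g : RAAG Γ), conjVertex Γ a g = conjVertex Γ a 1 := fun a g => by
    have h := conjVertex_mul_of_commute (hcomm a g) 1
    rwa [mul_one] at h
  obtain ⟨a, g, rfl⟩ := exists_eq_conjVertex x
  obtain ⟨b, h, rfl⟩ := exists_eq_conjVertex y
  obtain rfl := Subsingleton.elim a b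
  rw [heq a g, heq a h, SimpleGraph.dist_self]

instance countable_extensionVertex [Finite V] : Countable (ExtensionVertex Γ) := by
  have : Countable (RAAG Γ) := Function.Surjective.countable (f := val Γ) exists_val_eq
  exact Subtype.countable

end RAAG

theorem theorem4 {V : Type u} [Finite V] (Γ : SimpleGraph V) (hΓ : Γ.Connected) :
    IsQuasiTree (extensionGraph Γ) ∧
    IsHyperbolicGraph (extensionGraph Γ) ∧
    (IsNontrivialJoin Γ →
      (extensionGraph Γ).ediam ≠ ⊤ ∧ QuasiIsometric (extensionGraph Γ) pointGraph) ∧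
    (Nontrivial V → ¬ IsNontrivialJoin Γ →
      ∃ (W : Type) (T : SimpleGraph W),
        IsCountablyRegularTree T ∧ QuasiIsometric (extensionGraph Γ) T) := by
  have hG := RAAG.extensionGraph_connected hΓ
  obtain ⟨c, hc⟩ := RAAG.exists_hasBottleneck hΓ
  -- the layer tree of the extension graph, when `Γ` is neither a join nor a point
  have htree : Nontrivial V → ¬ IsNontrivialJoin Γ →
      ∃ (W : Type u) (_ : Countable W) (T : SimpleGraph W),
        IsCountablyRegularTree T ∧ QuasiIsometric (extensionGraph Γ) T := by
    intro hV hj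
    have hunb := RAAG.extensionGraph_unbounded hΓ (not_not.1 hj)
    obtain ⟨s, x₁, hx₁⟩ := hunb 1
    exact ⟨Layer (extensionGraph Γ) s, inferInstance, _,
      (RAAG.hasBranching_of_unbounded hG hunb).isCountablyRegularTree hG hx₁,
      hc.quasiIsometric_layer hG hx₁⟩
  refine ⟨?_, hc.isHyperbolicGraph hG, fun hj => ⟨?_, ?_⟩, fun hV hj => ?_⟩
  · by_cases hj : IsNontrivialJoin Γ
    · exact isQuasiTree_of_dist_le hG 4 (RAAG.dist_le_four_of_join hΓ hj)
    · rcases subsingleton_or_nontrivial V with hV | hV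
      · exact isQuasiTree_of_dist_le hG 0 fun x y => (RAAG.dist_eq_zero_of_subsingleton x y).le
      · obtain ⟨W, _, T, hT, hq⟩ := htree hV hj
        exact ⟨W, T, hT.1, hq⟩
  · have h : (extensionGraph Γ).ediam ≤ (4 : ℕ) := SimpleGraph.ediam_le_of_edist_le fun x y => by
      rw [← (hG.preconnected x y).coe_dist_eq_edist]
      exact_mod_cast RAAG.dist_le_four_of_join hΓ hj x y
    exact ne_top_of_le_ne_top (ENat.natCast_ne_top 4) h
  · exact quasiIsometric_bot_of_dist_le hG 4 (RAAG.dist_le_four_of_join hΓ hj)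
  · obtain ⟨W, _, T, hT, hq⟩ := htree hV hj
    exact exists_type_zero_countablyRegularTree hT hq
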